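/- Let $\mathbb M=(M_p)_{p\ge 0}$ be a sequence of positive real numbers with $M_0=1$, let $m_p=M_{p+1}/M_p$, and put $\widehat{\mathbb M}=(p!\,M_p)_{p\ge 0}$. Notation. $\mathbb M$ is a weight sequence if $M_p^2\le M_{p-1}M_{p+1}$ for all $p\ge 1$ and $m_p\to\infty$. It satisfies (sm) (shifted moments) if there are $C_0>0$, $H>1$ with $\log(m_{p+1}/m_p)\le C_0H^{p+1}$ for all $p\ge 0$. The index of $\mathbb M$ is $$\gamma(\mathbb M)=\sup\{\beta>0:\ \exists a>0\ \forall\, 0\le p\le q,\ m_p/(p+1)^\beta\le a\, m_q/(q+1)^\beta\}\in[0,\infty],$$ with $\sup\emptyset=0$. For $\gamma>0$ let $S_\gamma=\{z:\ |\arg z|<\gamma\pi/2\}$, a sector of the Riemann surface of the logarithm. For $h>0$: - $\mathbb C[[z]]_{\mathbb M,h}$ is the space of formal power series $\sum_p a_pz^p$ with norm $\sup_p |a_p|/(h^pM_p)<\infty$, and $\mathbb C[[z]]_{\{\mathbb M\}}=\bigcup_{h>0}\mathbb C[[z]]_{\mathbb M,h}$. - $\widetilde{\mathcal A}^u_{\mathbb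 M,h}(S_\gamma)$ is the space of holomorphic $f:S_\gamma\to\mathbb C$ for which there is a (necessarily unique) formal power series $\widetilde{\mathcal B}(f)=\sum_p a_pz^p$ with $$\|f\|=\sup_{z\in S_\gamma,\ p\ge 0}\frac{|f(z)-\sum_{k=0}^{p-1}a_kz^k|}{h^pM_p|z|^p}<\infty,$$ normed by $\|f\|$, and $\widetilde{\mathcal A}^u_{\{\mathbb M\}}(S_\gamma)=\bigcup_{h>0}\widetilde{\mathcal A}^u_{\mathbb M,h}(S_\gamma)$. - $\mathcal A_{\widehat{\mathbb M},h}(S_\gamma)$ is the space of holomorphic $f:S_\gamma\to\mathbb C$ with $\sup_{z\in S_\gamma,\ p\ge0}|f^{(p)}(z)|/(h^p\,p!\,M_p)<\infty$, and $\mathcal A_{\{\widehat{\mathbb M}\}}(S_\gamma)=\bigcup_{h>0}\mathcal A_{\widehat{\mathbb M},h}(S_\gamma)$; on it $\widetilde{\mathcal B}(f)=\sum_p \frac{f^{(p)}(0)}{p!}z^p$, where $f^{(p)}(0)=\lim_{z\to0,\,z\in S_\gamma}f^{(p)}(z)$. - $\widetilde S^u_{\{\mathbb M\}}$, respectively $S_{\{\widehat{\mathbb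 M}\}}$, is the set of $\gamma>0$ for which $\widetilde{\mathcal B}:\widetilde{\mathcal A}^u_{\{\mathbb M\}}(S_\gamma)\to\mathbb C[[z]]_{\{\mathbb M\}}$, respectively $\widetilde{\mathcal B}:\mathcal A_{\{\widehat{\mathbb M}\}}(S_\gamma)\to\mathbb C[[z]]_{\{\mathbb M\}}$, is surjective. Theorem. Let $\mathbb M$ be a weight sequence satisfying (sm) with $\gamma(\mathbb M)>0$, and let $\gamma>0$. Then each of the following statements implies the next one: (i) $\gamma<\gamma(\mathbb M)$. (ii) There exists $c>0$ such that for every $h>0$ there is a continuous linear map $T:\mathbb C[[z]]_{\mathbb M,h}\to\widetilde{\mathcal A}^u_{\mathbb M,ch}(S_\gamma)$ such that $\widetilde{\mathcal B}\circ T$ is the identity on $\mathbb C[[z]]_{\mathbb M,h}$. (iii) The Borel map $\widetilde{\mathcal B}:\widetilde{\mathcal A}^u_{\{\mathbb M\}}(S_\gamma)\to\mathbb C[[z]]_{\{\mathbb M\}}$ is surjective; equivalently, $(0,\gamma]\subset\widetilde S^u_{\{\mathbb M\}}$. (iv) $(0,\gamma)\subset S_{\{\widehat{\mathbb M}\}}$.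 In particular, $(0,\gamma(\mathbb M))\subset S_{\{\widehat{\mathbb M}\}}\subset\widetilde S^u_{\{\mathbb M\}}$. -/

import Mathlib

open Filter Topology

namespace Ultraholomorphic

noncomputable section

/-! ### Weight sequences -/

/-- A positive real number (an opening `γ` or a type parameter `h`). -/
abbrev PosReal : Type := {x : ℝ // 0 < x}

/-- A sequence `M = (M_p)` of positive real numbers with `M_0 = 1`. -/
structure PosSeq where
  toFun : ℕ → ℝ
  pos' : ∀ p, 0 < toFun p
  zero' : toFun 0 = 1

instance : CoeFun PosSeq (fun _ => ℕ → ℝ) := ⟨PosSeq.toFun⟩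

namespace PosSeq

/-- The sequence of quotients `m_p = M_{p+1} / M_p`. -/
def quot (M : PosSeq) (p : ℕ) : ℝ := M (p + 1) / M p

/-- The sequence `(p! M_p)_p`. -/
def hat (M : PosSeq) : PosSeq where
  toFun p := (p.factorial : ℝ) * M p
  pos' p := mul_pos (by exact_mod_cast p.factorial_pos) (M.pos' p)
  zero' := by simp [M.zero']

/-- Log-convexity: `M_p ^ 2 ≤ M_{p-1} M_{p+1}` for `p ≥ 1`. -/
def LogConvex (M : PosSeq) : Prop := ∀ p, M (p + 1) ^ 2 ≤ M p * M (p + 2)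

/-- A weight sequence: log-convex, with quotients tending to infinity. -/
def IsWeightSequence (M : PosSeq) : Prop := M.LogConvex ∧ Tendsto M.quot atTop atTop

/-- The condition (sm) of shifted moments. -/
def ShiftedMoments (M : PosSeq) : Prop :=
  ∃ C₀ H : ℝ, 0 < C₀ ∧ 1 < H ∧
    ∀ p : ℕ, Real.log (M.quot (p + 1) / M.quot p) ≤ C₀ * H ^ (p + 1)

end PosSeq

/-- Almost increasing sequences. -/
def AlmostIncreasing (c : ℕ → ℝ) : Prop := ∃ a : ℝ, 0 < a ∧ ∀ p q, p ≤ q → c p ≤ a * c q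

/-- The index `γ(M) ∈ [0, ∞]`. -/
def gammaIndex (M : PosSeq) : ENNReal :=
  sSup (ENNReal.ofReal ''
    {γ : ℝ | 0 < γ ∧ AlmostIncreasing (fun p => M.quot p / ((p : ℝ) + 1) ^ γ)})

/-! ### Sectors of the Riemann surface of the logarithm -/

/-- The Riemann surface of the logarithm, i.e. the universal covering of `ℂ \ {0}`,
given through its global holomorphic coordinate `log`. -/
@[ext] structure LogSurface where
  log : ℂ

namespace LogSurface

/-- The covering map onto `ℂ \ {0}`. -/
def proj (z : LogSurface) : ℂ := Complex.exp z.log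

/-- The modulus. -/
def abs (z : LogSurface) : ℝ := Real.exp z.log.re

/-- The argument, a real number which is not reduced modulo `2π`. -/
def arg (z : LogSurface) : ℝ := z.log.im

lemma abs_pos (z : LogSurface) : 0 < z.abs := Real.exp_pos _

lemma norm_proj (z : LogSurface) : ‖z.proj‖ = z.abs := Complex.norm_exp _

end LogSurface

/-- The unbounded sector `S_γ` bisected by direction `0` and with opening `π γ`. -/
def Sector (γ : PosReal) : Set LogSurface := {z | |z.arg| < γ * Real.pi / 2}

/-- The point of `S_γ` on the positive real line with modulus `r`. -/
def Sector.ofPos (γ : PosReal) (r : ℝ) : Sector γ :=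
  ⟨⟨(Real.log r : ℂ)⟩, by
    have h : 0 < (γ : ℝ) * Real.pi / 2 := by have := γ.2; positivity
    simpa [Sector, LogSurface.arg, Complex.ofReal_im] using h⟩

lemma Sector.abs_ofPos (γ : PosReal) {r : ℝ} (hr : 0 < r) : (Sector.ofPos γ r).1.abs = r := by
  simp only [Sector.ofPos, LogSurface.abs, Complex.ofReal_re, Real.exp_log hr]

variable {γ : PosReal}

/-- A function on `S_γ`, read in the coordinate `ζ = log z` (and extended by `0`). -/
def inLog (f : Sector γ → ℂ) : ℂ → ℂ := by
  classical
  exact fun ζ => if h : (⟨ζ⟩ : LogSurface) ∈ Sector γ then f ⟨⟨ζ⟩, h⟩ else 0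

lemma inLog_apply (f : Sector γ → ℂ) (z : Sector γ) : inLog f z.1.log = f z := by
  have h : (⟨z.1.log⟩ : LogSurface) ∈ Sector γ := z.2
  unfold inLog
  exact dif_pos h

/-- The image of `S_γ` in the coordinate `log`: an open horizontal strip. -/
def logStrip (γ : PosReal) : Set ℂ := {ζ | (⟨ζ⟩ : LogSurface) ∈ Sector γ}

/-- Holomorphic functions on `S_γ`. -/
def Holomorphic (f : Sector γ → ℂ) : Prop := DifferentiableOn ℂ (inLog f) (logStrip γ)

/-- The complex derivative `f' = df/dz` on `S_γ`, where `z = exp ζ` is the local coordinate given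
by the covering map; by the chain rule `df/dz = exp(-ζ) df/dζ`. -/
def sderiv (f : Sector γ → ℂ) (z : Sector γ) : ℂ := deriv (inLog f) z.1.log / z.1.proj

/-- The `p`-th derivative `f^(p)` on `S_γ`. -/
def iterSderiv (p : ℕ) (f : Sector γ → ℂ) : Sector γ → ℂ := sderiv^[p] f

/-- The filter of `z → 0` with `z ∈ S_γ`. -/
def toVertex (γ : PosReal) : Filter (Sector γ) := comap (fun z : Sector γ => z.1.abs) (𝓝 0)

/-- `f^(p)(0)`, the limit of `f^(p)(z)` as `z → 0` in `S_γ`. -/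
def derivAtVertex (f : Sector γ → ℂ) (p : ℕ) : ℂ := limUnder (toVertex γ) (iterSderiv p f)

/-! ### Classes of formal power series -/

/-- The space `ℂ[[z]]_{M,h}`, as a submodule of `ℂ[[z]]`. -/
def formalSubmodule (M : PosSeq) (h : PosReal) : Submodule ℂ (PowerSeries ℂ) where
  carrier := {a | ∃ C : ℝ, ∀ p : ℕ, ‖PowerSeries.coeff p a‖ ≤ C * ((h : ℝ) ^ p * M p)}
  zero_mem' := ⟨0, fun p => by simp⟩
  add_mem' := by
    rintro a b ⟨C, hC⟩ ⟨D, hD⟩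
    refine ⟨C + D, fun p => ?_⟩
    rw [map_add, add_mul]
    exact (norm_add_le _ _).trans (add_le_add (hC p) (hD p))
  smul_mem' := by
    rintro c a ⟨C, hC⟩
    refine ⟨‖c‖ * C, fun p => ?_⟩
    rw [map_smul, norm_smul, mul_assoc]
    exact mul_le_mul_of_nonneg_left (hC p) (norm_nonneg c)

/-- The space `ℂ[[z]]_{M,h}`. -/
def Formal (M : PosSeq) (h : PosReal) : Type := formalSubmodule M h

instance (M : PosSeq) (h : PosReal) : AddCommGroup (Formal M h) :=
  inferInstanceAs (AddCommGroup (formalSubmodule M h))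

instance (M : PosSeq) (h : PosReal) : Module ℂ (Formal M h) :=
  inferInstanceAs (Module ℂ (formalSubmodule M h))

/-- The inclusion `ℂ[[z]]_{M,h} → ℂ[[z]]`. -/
def Formal.val {M : PosSeq} {h : PosReal} : Formal M h →ₗ[ℂ] PowerSeries ℂ :=
  (formalSubmodule M h).subtype

/-- The norm `|a|_{M,h} = sup_p |a_p| / (h^p M_p)`. -/
instance (M : PosSeq) (h : PosReal) : Norm (Formal M h) :=
  ⟨fun a => ⨆ p : ℕ, ‖PowerSeries.coeff p a.val‖ / ((h : ℝ) ^ p * M p)⟩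

/-- The class `ℂ[[z]]_{{M}}`, the union of the `ℂ[[z]]_{M,h}`, `h > 0`. -/
def formalRoumieu (M : PosSeq) : Set (PowerSeries ℂ) := ⋃ h : PosReal, formalSubmodule M h

/-! ### Uniform asymptotic expansions -/

/-- The remainder of order `p`: `f(z) - ∑_{k<p} a_k z^k`. -/
def remainder (f : Sector γ → ℂ) (a : PowerSeries ℂ) (p : ℕ) (z : Sector γ) : ℂ :=
  f z - ∑ k ∈ Finset.range p, PowerSeries.coeff k a * z.1.proj ^ k

/-- `f` admits `a` as its uniform `M`-asymptotic expansion of type `1/h` in `S_γ` (the estimates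
only; holomorphy is required separately). -/
def HasUniformExpansion (M : PosSeq) (h : PosReal) (f : Sector γ → ℂ) (a : PowerSeries ℂ) : Prop :=
  ∃ C : ℝ, 0 < C ∧ ∀ (p : ℕ) (z : Sector γ),
    ‖remainder f a p z‖ ≤ C * ((h : ℝ) ^ p * M p * z.1.abs ^ p)

lemma remainder_add (f g : Sector γ → ℂ) (a b : PowerSeries ℂ) (p : ℕ) (z : Sector γ) :
    remainder (f + g) (a + b) p z = remainder f a p z + remainder g b p z := by
  simp only [remainder, Pi.add_apply, map_add, add_mul, Finset.sum_add_distrib]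
  ring

lemma remainder_smul (c : ℂ) (f : Sector γ → ℂ) (a : PowerSeries ℂ) (p : ℕ) (z : Sector γ) :
    remainder (c • f) (c • a) p z = c * remainder f a p z := by
  simp only [remainder, Pi.smul_apply, smul_eq_mul, map_smul, mul_sub, Finset.mul_sum, mul_assoc]

lemma HasUniformExpansion.add {M : PosSeq} {h : PosReal} {f g : Sector γ → ℂ}
    {a b : PowerSeries ℂ} (hf : HasUniformExpansion M h f a) (hg : HasUniformExpansion M h g b) :
    HasUniformExpansion M h (f + g) (a + b) := by
  obtain ⟨C, hC0, hC⟩ := hf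
  obtain ⟨D, hD0, hD⟩ := hg
  refine ⟨C + D, by positivity, fun p z => ?_⟩
  rw [remainder_add, add_mul]
  exact (norm_add_le _ _).trans (add_le_add (hC p z) (hD p z))

lemma weight_pos (M : PosSeq) (h : PosReal) (p : ℕ) (z : Sector γ) :
    0 < (h : ℝ) ^ p * M p * z.1.abs ^ p := by
  have := h.2
  have := M.pos' p
  have := z.1.abs_pos
  positivity

lemma HasUniformExpansion.smul {M : PosSeq} {h : PosReal} {f : Sector γ → ℂ}
    {a : PowerSeries ℂ} (c : ℂ) (hf : HasUniformExpansion M h f a) :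
    HasUniformExpansion M h (c • f) (c • a) := by
  obtain ⟨C, hC0, hC⟩ := hf
  refine ⟨‖c‖ * C + 1, by positivity, fun p z => ?_⟩
  rw [remainder_smul, norm_mul]
  have h1 := mul_le_mul_of_nonneg_left (hC p z) (norm_nonneg c)
  have h2 := weight_pos M h p z
  nlinarith

/-- The uniform asymptotic expansion is unique. -/
lemma HasUniformExpansion.unique {M : PosSeq} {h k : PosReal} {f : Sector γ → ℂ}
    {a b : PowerSeries ℂ} (hf : HasUniformExpansion M h f a) (hg : HasUniformExpansion M k f b) :
    a = b := by
  obtain ⟨C, hC0, hC⟩ := hf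
  obtain ⟨D, hD0, hD⟩ := hg
  ext n
  induction n using Nat.strong_induction_on with
  | _ n ih =>
  set E : ℝ := C * ((h : ℝ) ^ (n + 1) * M (n + 1)) + D * ((k : ℝ) ^ (n + 1) * M (n + 1)) with hE
  have key : ∀ r : ℝ, 0 < r → ‖PowerSeries.coeff n a - PowerSeries.coeff n b‖ ≤ E * r := by
    intro r hr
    set z := Sector.ofPos γ r
    have hz : z.1.abs = r := Sector.abs_ofPos γ hr
    have h1 := hC (n + 1) z
    have h2 := hD (n + 1) z
    have h3 : remainder f b (n + 1) z - remainder f a (n + 1) z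
        = (PowerSeries.coeff n a - PowerSeries.coeff n b) * z.1.proj ^ n := by
      simp only [remainder, Finset.sum_range_succ]
      have hs : ∑ j ∈ Finset.range n, PowerSeries.coeff j a * z.1.proj ^ j
          = ∑ j ∈ Finset.range n, PowerSeries.coeff j b * z.1.proj ^ j :=
        Finset.sum_congr rfl fun j hj => by rw [ih j (Finset.mem_range.1 hj)]
      rw [hs]
      ring
    have h4 := norm_sub_le (remainder f b (n + 1) z) (remainder f a (n + 1) z)
    rw [h3, norm_mul, norm_pow, LogSurface.norm_proj, hz] at h4
    rw [hz] at h1 h2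
    have h5 : ‖PowerSeries.coeff n a - PowerSeries.coeff n b‖ * r ^ n ≤ (E * r) * r ^ n := by
      rw [hE]
      calc _ ≤ _ := h4
        _ ≤ _ := add_le_add h2 h1
        _ = _ := by ring
    exact le_of_mul_le_mul_right h5 (by positivity)
  have hlim : Tendsto (fun r : ℝ => E * r) (𝓝[>] 0) (𝓝 0) := by
    have : Tendsto (fun r : ℝ => E * r) (𝓝 0) (𝓝 (E * 0)) := (continuous_const_mul E).tendsto 0
    rw [mul_zero] at this
    exact this.mono_left nhdsWithin_le_nhds
  have h0 : ‖PowerSeries.coeff n a - PowerSeries.coeff n b‖ ≤ 0 :=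
    ge_of_tendsto hlim (eventually_nhdsWithin_of_forall fun r hr => key r hr)
  exact sub_eq_zero.1 (norm_le_zero_iff.1 h0)

/-- The asymptotic Borel map, sending a function with a uniform `M`-asymptotic expansion (of some
type) to that expansion. -/
def borel (M : PosSeq) (f : Sector γ → ℂ) : PowerSeries ℂ := by
  classical
  exact if hf : ∃ a : PowerSeries ℂ, ∃ h : PosReal, HasUniformExpansion M h f a then hf.choose else 0

lemma HasUniformExpansion.borel_eq {M : PosSeq} {h : PosReal} {f : Sector γ → ℂ}
    {a : PowerSeries ℂ} (hf : HasUniformExpansion M h f a) : borel M f = a := by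
  have hex : ∃ a : PowerSeries ℂ, ∃ h : PosReal, HasUniformExpansion M h f a := ⟨a, h, hf⟩
  have : borel M f = hex.choose := dif_pos hex
  rw [this]
  obtain ⟨k, hk⟩ := hex.choose_spec
  exact hk.unique hf

lemma inLog_add (f g : Sector γ → ℂ) : inLog (f + g) = inLog f + inLog g := by
  funext ζ
  by_cases h : (⟨ζ⟩ : LogSurface) ∈ Sector γ <;> simp [inLog, h]

lemma inLog_smul (c : ℂ) (f : Sector γ → ℂ) : inLog (c • f) = c • inLog f := by
  funext ζ
  by_cases h : (⟨ζ⟩ : LogSurface) ∈ Sector γ <;> simp [inLog, h]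

/-- The space of holomorphic functions on `S_γ` with a uniform `M`-asymptotic expansion of type
`1/h`, as a submodule of the space of all functions on `S_γ`. -/
def uniformSubmodule (M : PosSeq) (h γ : PosReal) : Submodule ℂ (Sector γ → ℂ) where
  carrier := {f | Holomorphic f ∧ ∃ a, HasUniformExpansion M h f a}
  zero_mem' := by
    refine ⟨?_, 0, 1, one_pos, fun p z => ?_⟩
    · have : inLog (0 : Sector γ → ℂ) = 0 := by funext ζ; simp [inLog]
      rw [Holomorphic, this]
      exact differentiableOn_const (0 : ℂ)
    · simpa [remainder] using (weight_pos M h p z).le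
  add_mem' := by
    rintro f g ⟨hf, a, ha⟩ ⟨hg, b, hb⟩
    refine ⟨?_, a + b, ha.add hb⟩
    rw [Holomorphic, inLog_add]
    exact DifferentiableOn.add hf hg
  smul_mem' := by
    rintro c f ⟨hf, a, ha⟩
    refine ⟨?_, c • a, ha.smul c⟩
    rw [Holomorphic, inLog_smul]
    exact DifferentiableOn.const_smul hf c

/-- The space `Ã^u_{M,h}(S_γ)`. -/
def Uniform (M : PosSeq) (h γ : PosReal) : Type := uniformSubmodule M h γ

instance (M : PosSeq) (h γ : PosReal) : AddCommGroup (Uniform M h γ) :=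
  inferInstanceAs (AddCommGroup (uniformSubmodule M h γ))

instance (M : PosSeq) (h γ : PosReal) : Module ℂ (Uniform M h γ) :=
  inferInstanceAs (Module ℂ (uniformSubmodule M h γ))

/-- The inclusion of `Ã^u_{M,h}(S_γ)` into the space of all functions on `S_γ`. -/
def Uniform.val {M : PosSeq} {h : PosReal} : Uniform M h γ →ₗ[ℂ] (Sector γ → ℂ) :=
  (uniformSubmodule M h γ).subtype

/-- The norm `sup_{z,p} |f(z) - ∑_{k<p} a_k z^k| / (h^p M_p |z|^p)`, with `∑ a_k z^k` the
asymptotic expansion of `f`. -/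
instance (M : PosSeq) (h γ : PosReal) : Norm (Uniform M h γ) :=
  ⟨fun f => ⨆ x : Sector γ × ℕ,
    ‖remainder f.val (borel M f.val) x.2 x.1‖ / ((h : ℝ) ^ x.2 * M x.2 * x.1.1.abs ^ x.2)⟩

/-- The class `Ã^u_{{M}}(S_γ)`, the union of the `Ã^u_{M,h}(S_γ)`, `h > 0`. -/
def uniformRoumieu (M : PosSeq) (γ : PosReal) : Set (Sector γ → ℂ) :=
  ⋃ h : PosReal, uniformSubmodule M h γ

/-! ### The normed space structures -/

/-- A supremum of the moduli of linear coordinates is a norm if it is finite and the coordinates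
separate points. -/
lemma core_of_iSup {E ι : Type*} [AddCommGroup E] [Module ℂ E] [Norm E] [Nonempty ι]
    (Φ : ι → E → ℂ) (hadd : ∀ i x y, Φ i (x + y) = Φ i x + Φ i y)
    (hsmul : ∀ i (c : ℂ) x, Φ i (c • x) = c * Φ i x)
    (hnorm : ∀ x, ‖x‖ = ⨆ i, ‖Φ i x‖) (hbdd : ∀ x, BddAbove (Set.range fun i => ‖Φ i x‖))
    (hinj : ∀ x, (∀ i, Φ i x = 0) → x = 0) : NormedSpace.Core ℂ E where
  norm_nonneg x := by
    rw [hnorm]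
    exact Real.iSup_nonneg fun i => norm_nonneg _
  norm_smul c x := by
    rw [hnorm, hnorm, Real.mul_iSup_of_nonneg (norm_nonneg c)]
    simp only [hsmul, norm_mul]
  norm_triangle x y := by
    rw [hnorm, hnorm, hnorm]
    refine ciSup_le fun i => ?_
    rw [hadd]
    exact (norm_add_le _ _).trans (add_le_add (le_ciSup (hbdd x) i) (le_ciSup (hbdd y) i))
  norm_eq_zero_iff x := by
    rw [hnorm]
    constructor
    · intro h
      refine hinj x fun i => ?_
      have := le_ciSup (hbdd x) i
      rw [h] at this
      exact norm_le_zero_iff.1 this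
    · rintro rfl
      have h0 : ∀ i, Φ i 0 = 0 := fun i => by simpa using hsmul i 0 0
      simp [h0]

lemma Formal.core (M : PosSeq) (h : PosReal) : NormedSpace.Core ℂ (Formal M h) := by
  have hpos : ∀ p : ℕ, 0 < (h : ℝ) ^ p * M p := fun p => mul_pos (pow_pos h.2 p) (M.pos' p)
  have hn : ∀ (p : ℕ) (w : ℂ), ‖w / (((h : ℝ) ^ p * M p : ℝ) : ℂ)‖ = ‖w‖ / ((h : ℝ) ^ p * M p) :=
    fun p w => by rw [norm_div, Complex.norm_real, Real.norm_of_nonneg (hpos p).le]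
  refine core_of_iSup
    (fun (p : ℕ) a => PowerSeries.coeff p a.val / (((h : ℝ) ^ p * M p : ℝ) : ℂ)) ?_ ?_ ?_ ?_ ?_
  · intro p a b
    rw [map_add, map_add, add_div]
  · intro p c a
    rw [map_smul, map_smul, smul_eq_mul, mul_div_assoc]
  · intro a
    simp only [hn]
    rfl
  · intro a
    obtain ⟨C, hC⟩ := a.2
    refine ⟨C, ?_⟩
    rintro _ ⟨p, rfl⟩
    simp only [hn]
    exact (div_le_iff₀ (hpos p)).2 (hC p)
  · intro a ha
    refine Subtype.ext (PowerSeries.ext fun p => ?_)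
    have h1 := ha p
    rw [div_eq_zero_iff] at h1
    rcases h1 with h1 | h1
    · exact h1
    · exact absurd (Complex.ofReal_eq_zero.1 h1) (hpos p).ne'

instance (M : PosSeq) (h : PosReal) : NormedAddCommGroup (Formal M h) :=
  NormedAddCommGroup.ofCore (Formal.core M h)

instance (M : PosSeq) (h : PosReal) : NormedSpace ℂ (Formal M h) :=
  NormedSpace.ofCore (Formal.core M h)

lemma Uniform.hasUniformExpansion {M : PosSeq} {h : PosReal} (f : Uniform M h γ) :
    HasUniformExpansion M h f.val (borel M f.val) := by
  obtain ⟨-, a, ha⟩ := f.2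
  have : borel M f.val = a := HasUniformExpansion.borel_eq ha
  rw [this]
  exact ha

lemma Uniform.core (M : PosSeq) (h γ : PosReal) : NormedSpace.Core ℂ (Uniform M h γ) := by
  have hn : ∀ (x : Sector γ × ℕ) (w : ℂ),
      ‖w / (((h : ℝ) ^ x.2 * M x.2 * x.1.1.abs ^ x.2 : ℝ) : ℂ)‖
        = ‖w‖ / ((h : ℝ) ^ x.2 * M x.2 * x.1.1.abs ^ x.2) := fun x w => by
    rw [norm_div, Complex.norm_real, Real.norm_of_nonneg (weight_pos M h x.2 x.1).le]
  have : Nonempty (Sector γ × ℕ) := ⟨(Sector.ofPos γ 1, 0)⟩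
  refine core_of_iSup (fun (x : Sector γ × ℕ) f => remainder f.val (borel M f.val) x.2 x.1
    / (((h : ℝ) ^ x.2 * M x.2 * x.1.1.abs ^ x.2 : ℝ) : ℂ)) ?_ ?_ ?_ ?_ ?_
  · intro x f g
    have : borel M (f + g).val = borel M f.val + borel M g.val := by
      rw [map_add]
      exact (f.hasUniformExpansion.add g.hasUniformExpansion).borel_eq
    simp only [this]
    rw [map_add, remainder_add, add_div]
  · intro x c f
    have : borel M (c • f).val = c • borel M f.val := by
      rw [map_smul]
      exact (f.hasUniformExpansion.smul c).borel_eq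
    simp only [this]
    rw [map_smul, remainder_smul, mul_div_assoc]
  · intro f
    simp only [hn]
    rfl
  · intro f
    obtain ⟨C, -, hC⟩ := f.hasUniformExpansion
    refine ⟨C, ?_⟩
    rintro _ ⟨x, rfl⟩
    simp only [hn]
    exact (div_le_iff₀ (weight_pos M h x.2 x.1)).2 (hC x.2 x.1)
  · intro f hf
    refine Subtype.ext (funext fun z => ?_)
    have h1 := hf (z, 0)
    simp only [remainder, Finset.range_zero, Finset.sum_empty, sub_zero, pow_zero, mul_one,
      M.zero', Complex.ofReal_one, div_one] at h1
    exact h1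

instance (M : PosSeq) (h γ : PosReal) : NormedAddCommGroup (Uniform M h γ) :=
  NormedAddCommGroup.ofCore (Uniform.core M h γ)

instance (M : PosSeq) (h γ : PosReal) : NormedSpace ℂ (Uniform M h γ) :=
  NormedSpace.ofCore (Uniform.core M h γ)

/-- `T : ℂ[[z]]_{M,h} → Ã^u_{M,k}(S_γ)`, linear and continuous for the norms above, is an
extension operator: the Borel map composed with `T` is the identity. -/
def IsExtensionOperator {M : PosSeq} {h k γ : PosReal} (T : Formal M h →L[ℂ] Uniform M k γ) :
    Prop :=
  ∀ a : Formal M h, borel M (T a).val = a.val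

/-- There is `c > 0` such that for every `h > 0` there is an extension operator from
`ℂ[[z]]_{M,h}` into `Ã^u_{M,ch}(S_γ)`. -/
def HasLocalExtensionOperators (M : PosSeq) (γ : PosReal) : Prop :=
  ∃ c : PosReal, ∀ h : PosReal,
    ∃ T : Formal M h →L[ℂ] Uniform M (c * h) γ, IsExtensionOperator T

/-! ### Ultraholomorphic classes defined through derivatives -/

/-- The class `A_{N,h}(S_γ)`. -/
def derivClass (N : PosSeq) (h γ : PosReal) : Set (Sector γ → ℂ) :=
  {f | Holomorphic f ∧
    ∃ C : ℝ, ∀ (p : ℕ) (z : Sector γ), ‖iterSderiv p f z‖ ≤ C * ((h : ℝ) ^ p * N p)}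

/-- The Carleman-Roumieu class `A_{{N}}(S_γ)`, the union of the `A_{N,h}(S_γ)`, `h > 0`. -/
def derivRoumieu (N : PosSeq) (γ : PosReal) : Set (Sector γ → ℂ) :=
  ⋃ h : PosReal, derivClass N h γ

/-- The Borel map on the classes defined through derivatives: `f ↦ ∑ f^(p)(0) / p! z^p`. -/
def taylorBorel (f : Sector γ → ℂ) : PowerSeries ℂ :=
  PowerSeries.mk fun p => derivAtVertex f p / (p.factorial : ℂ)

/-! ### Surjectivity -/

/-- The Borel map `Ã^u_{{M}}(S_γ) → ℂ[[z]]_{{M}}` is surjective. -/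
def UniformBorelSurjective (M : PosSeq) (γ : PosReal) : Prop :=
  Set.SurjOn (borel M) (uniformRoumieu M γ) (formalRoumieu M)

/-- The Borel map `A_{{M̂}}(S_γ) → ℂ[[z]]_{{M}}` is surjective, where `M̂ = (p! M_p)`. -/
def DerivBorelSurjective (M : PosSeq) (γ : PosReal) : Prop :=
  Set.SurjOn taylorBorel (derivRoumieu M.hat γ) (formalRoumieu M)

/-- The surjectivity interval of the classes `Ã^u_{{M}}`. -/
def uniformSurjInterval (M : PosSeq) : Set ℝ :=
  {γ | ∃ hγ : 0 < γ, UniformBorelSurjective M ⟨γ, hγ⟩}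

/-- The surjectivity interval of the classes `A_{{M̂}}`, where `M̂ = (p! M_p)`. -/
def derivSurjInterval (M : PosSeq) : Set ℝ :=
  {γ | ∃ hγ : 0 < γ, DerivBorelSurjective M ⟨γ, hγ⟩}

end

end Ultraholomorphic

open Ultraholomorphic

namespace Ultraholomorphic

open MeasureTheory

/-! ### Derivatives in the logarithmic coordinate -/

/-! Everything is done in the coordinate `ζ = log z`, where a sector of any opening becomes a convex
horizontal strip.

(i) ⇒ (ii) is a truncated Laplace transform. Choose `γ < α < β` with `m_p / (p+1)^β` almost
increasing, and let `e(z) = ∏ (1 + (z/m_p)^(1/α))^(-α)`. On `S_α` each power lies in the right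
half-plane, where `|1 + w| ≥ max(1, |w|)`; hence `|e(z)| ≤ M_k / |z|^k` for every `k`
(`norm_kernel_le`). Since `β/α > 1`, the tails `∑_{p ≥ k} (m_k/m_p)^(1/α)` are `O(k+1)`. This makes
the product converge and bounds `e(m_k)` from below, so the moments `μ_k = ∫ e(u) u^(k-1) du`
satisfy `M_k ≤ B^(k+1) μ_k` for `k ≥ 1` (`exists_moment_lower_bound`).

Given `∑ a_k z^k` of type `h`, the series `∑ (a_k/μ_k) u^k`, `k ≥ 1`, therefore converges near 0.
Cut it off at a radius `R` proportional to `1/h` and integrate it against `e(u/z) du/u`. Monomials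
transform into `μ_k z^k` (`kernelTransform_exp`), so the remainder of order `p` is the transform of
a function bounded by a multiple of `(u/R)^p`, inside and outside the cutoff
(`norm_cutoffSum_sub_le`). Integrating the bounds on `e` costs `M_p (2 + log(m_p/m_(p-1)))`
(`integral_envelope`), and (sm) makes the logarithm at most geometric. All operations are linear in
`a`, and the loss of type is a factor independent of `h`.

(ii) ⇒ (iii) applies the operator on each `ℂ[[z]]_{M,h}`; the equivalence in (iii) is restriction to
smaller sectors. (iii) ⇒ (iv) is Cauchy's estimate on discs of radius proportional to `|z|`, which
fit once the opening is reduced (`UniformBorelSurjective.deriv`). The last inclusion is Taylor's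
formula at the vertex, with no loss of opening (`DerivBorelSurjective.uniform`). -/

lemma mem_logStrip {γ : PosReal} {ζ : ℂ} : ζ ∈ logStrip γ ↔ |ζ.im| < γ * Real.pi / 2 := Iff.rfl

lemma isOpen_logStrip (γ : PosReal) : IsOpen (logStrip γ) :=
  isOpen_lt (continuous_abs.comp Complex.continuous_im) continuous_const

lemma convex_logStrip (γ : PosReal) : Convex ℝ (logStrip γ) := by
  have h : logStrip γ = {ζ | -(γ * Real.pi / 2) < ζ.im} ∩ {ζ | ζ.im < γ * Real.pi / 2} := by
    ext ζ
    rw [mem_logStrip, abs_lt]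
    rfl
  rw [h]
  exact (convex_halfSpace_im_gt _).inter (convex_halfSpace_im_lt _)

lemma logStrip_mono {γ δ : PosReal} (h : (δ : ℝ) ≤ γ) : logStrip δ ⊆ logStrip γ := fun ζ hζ => by
  rw [mem_logStrip] at hζ ⊢
  exact hζ.trans_le (by gcongr)

/-- The derivation `exp(-ζ) d/dζ`, which is `d/dz` in the coordinate `ζ = log z`. -/
noncomputable def expDeriv (g : ℂ → ℂ) (ζ : ℂ) : ℂ := deriv g ζ / Complex.exp ζ

lemma eqOn_iterate_expDeriv {U : Set ℂ} (hU : IsOpen U) {g₁ g₂ : ℂ → ℂ} (h : Set.EqOn g₁ g₂ U)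
    (p : ℕ) : Set.EqOn (expDeriv^[p] g₁) (expDeriv^[p] g₂) U := by
  induction p with
  | zero => exact h
  | succ p ih =>
    intro ζ hζ
    rw [Function.iterate_succ_apply', Function.iterate_succ_apply', expDeriv, expDeriv,
      (ih.eventuallyEq_of_mem (hU.mem_nhds hζ)).deriv_eq]

lemma differentiableOn_iterate_expDeriv {U : Set ℂ} (hU : IsOpen U) {g : ℂ → ℂ}
    (h : DifferentiableOn ℂ g U) (p : ℕ) : DifferentiableOn ℂ (expDeriv^[p] g) U := by
  induction p with
  | zero => exact h
  | succ p ih =>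
    rw [Function.iterate_succ_apply']
    exact (ih.deriv hU).div Complex.differentiable_exp.differentiableOn
      fun ζ _ => Complex.exp_ne_zero ζ

lemma hasDerivAt_iterate_expDeriv {U : Set ℂ} (hU : IsOpen U) {g : ℂ → ℂ}
    (h : DifferentiableOn ℂ g U) (p : ℕ) {ζ : ℂ} (hζ : ζ ∈ U) :
    HasDerivAt (expDeriv^[p] g) (Complex.exp ζ * expDeriv^[p + 1] g ζ) ζ := by
  have h1 : Complex.exp ζ * expDeriv^[p + 1] g ζ = deriv (expDeriv^[p] g) ζ := by
    rw [Function.iterate_succ_apply', expDeriv, mul_div_cancel₀ _ (Complex.exp_ne_zero ζ)]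
  rw [h1]
  exact ((differentiableOn_iterate_expDeriv hU h p).differentiableAt (hU.mem_nhds hζ)).hasDerivAt

lemma eqOn_inLog_iterSderiv {γ : PosReal} (f : Sector γ → ℂ) (p : ℕ) :
    Set.EqOn (inLog (iterSderiv p f)) (expDeriv^[p] (inLog f)) (logStrip γ) := by
  induction p with
  | zero => exact fun _ _ => rfl
  | succ p ih =>
    intro ζ hζ
    have h1 := inLog_apply (iterSderiv (p + 1) f) ⟨⟨ζ⟩, hζ⟩
    simp only at h1
    rw [h1, Function.iterate_succ_apply', expDeriv,
      ← (ih.eventuallyEq_of_mem ((isOpen_logStrip γ).mem_nhds hζ)).deriv_eq, iterSderiv,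
      Function.iterate_succ_apply']
    rfl

lemma iterSderiv_eq {γ : PosReal} (f : Sector γ → ℂ) (p : ℕ) (z : Sector γ) :
    iterSderiv p f z = expDeriv^[p] (inLog f) z.1.log := by
  rw [← eqOn_inLog_iterSderiv f p z.2, inLog_apply]

/-- The branch of the logarithm near `exp ζ₀` with value `ζ₀` at `exp ζ₀`. -/
noncomputable def logBranch (ζ₀ w : ℂ) : ℂ := ζ₀ + Complex.log (w * Complex.exp (-ζ₀))

lemma exp_logBranch {ζ₀ w : ℂ} (hw : w ≠ 0) : Complex.exp (logBranch ζ₀ w) = w := by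
  rw [logBranch, Complex.exp_add, Complex.exp_log (mul_ne_zero hw (Complex.exp_ne_zero _)),
    mul_left_comm, ← Complex.exp_add]
  simp

lemma hasDerivAt_logBranch {ζ₀ w : ℂ} (hw : w * Complex.exp (-ζ₀) ∈ Complex.slitPlane) :
    HasDerivAt (logBranch ζ₀) w⁻¹ w := by
  have hw0 : w ≠ 0 := left_ne_zero_of_mul (Complex.slitPlane_ne_zero hw)
  have h1 : HasDerivAt (fun w : ℂ => w * Complex.exp (-ζ₀)) (1 * Complex.exp (-ζ₀)) w :=
    (hasDerivAt_id w).mul_const _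
  have h2 := (h1.clog hw).const_add ζ₀
  convert! h2 using 1
  rw [one_mul, div_mul_cancel_right₀ (Complex.exp_ne_zero _)]

/-- The factor `1/w` from the chain rule cancels the `exp` hidden in `expDeriv`. Thus iterates of
`expDeriv` are ordinary derivatives in the plane, to which Cauchy's estimates apply. -/
lemma iteratedDeriv_comp_logBranch {U V : Set ℂ} (hU : IsOpen U) (hV : IsOpen V) {g : ℂ → ℂ}
    (hg : DifferentiableOn ℂ g U) {ζ₀ : ℂ}
    (hslit : ∀ w ∈ V, w * Complex.exp (-ζ₀) ∈ Complex.slitPlane)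
    (hmaps : Set.MapsTo (logBranch ζ₀) V U) (p : ℕ) :
    Set.EqOn (iteratedDeriv p (g ∘ logBranch ζ₀)) (expDeriv^[p] g ∘ logBranch ζ₀) V := by
  induction p with
  | zero => intro w _; simp
  | succ p ih =>
    intro w hw
    have hw0 : w ≠ 0 := left_ne_zero_of_mul (Complex.slitPlane_ne_zero (hslit w hw))
    rw [iteratedDeriv_succ, (ih.eventuallyEq_of_mem (hV.mem_nhds hw)).deriv_eq]
    have h1 := (hasDerivAt_iterate_expDeriv hU hg p (hmaps hw)).comp w
      (hasDerivAt_logBranch (hslit w hw))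
    rw [h1.deriv, exp_logBranch hw0]
    simp only [Function.comp_apply]
    field_simp

/-- The image of a small disc around `exp ζ₀` under the branch of the logarithm. -/
lemma norm_logBranch_sub_le {ζ₀ w : ℂ} {r : ℝ} (hr : r ≤ 1 / 2)
    (hw : ‖w - Complex.exp ζ₀‖ ≤ r * Real.exp ζ₀.re) :
    w * Complex.exp (-ζ₀) ∈ Complex.slitPlane ∧ ‖logBranch ζ₀ w - ζ₀‖ ≤ 3 / 2 * r := by
  set v := w * Complex.exp (-ζ₀) - 1 with hv
  have hvr : ‖v‖ ≤ r := by
    have h1 : v = (w - Complex.exp ζ₀) * Complex.exp (-ζ₀) := by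
      rw [sub_mul, ← Complex.exp_add]; simp [hv]
    rw [h1, norm_mul, Complex.norm_exp, Complex.neg_re, Real.exp_neg, ← div_eq_mul_inv,
      div_le_iff₀ (Real.exp_pos _)]
    exact hw
  have hwv : w * Complex.exp (-ζ₀) = 1 + v := by simp [hv]
  refine ⟨?_, ?_⟩
  · rw [hwv]
    exact Complex.mem_slitPlane_of_norm_lt_one (by linarith)
  · rw [logBranch, add_sub_cancel_left, hwv]
    exact (Complex.norm_log_one_add_half_le_self (hvr.trans hr)).trans (by gcongr)

/-- Cauchy's estimates for the remainders in a smaller sector. -/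
lemma norm_iterate_expDeriv_sub_le {γ : PosReal} {f : Sector γ → ℂ} (hf : Holomorphic f)
    {a : PowerSeries ℂ} {n : ℕ} {K : ℝ} (hK0 : 0 ≤ K)
    (hK : ∀ z : Sector γ, ‖remainder f a n z‖ ≤ K * z.1.abs ^ n)
    {r : ℝ} (hr0 : 0 < r) (hr : r ≤ 1 / 2) {ζ : ℂ} (hζ : |ζ.im| + 3 / 2 * r < γ * Real.pi / 2)
    (p : ℕ) :
    ‖expDeriv^[p] (inLog f) ζ - ∑ k ∈ Finset.range n, PowerSeries.coeff k a *
        ((k.descFactorial p : ℂ) * Complex.exp ζ ^ (k - p))‖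
      ≤ p.factorial * (K * ((1 + r) * Real.exp ζ.re) ^ n) / (r * Real.exp ζ.re) ^ p := by
  have he := Real.exp_pos ζ.re
  -- The disc of radius `r |z|` about `z = exp ζ` lifts into the disc of radius `3r/2` about `ζ`,
  -- which the hypothesis on `ζ` keeps inside the strip.
  have himg : ∀ η : ℂ, ‖η - ζ‖ ≤ 3 / 2 * r → η ∈ logStrip γ := fun η hη => by
    have h1 := (Complex.abs_im_le_norm (η - ζ)).trans hη
    have h2 : |η.im| ≤ |ζ.im| + |(η - ζ).im| := by
      have := abs_add_le ζ.im (η - ζ).im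
      rwa [Complex.sub_im, add_sub_cancel] at this
    rw [mem_logStrip]
    linarith
  set c := Complex.exp ζ with hc
  have hcn : ‖c‖ = Real.exp ζ.re := Complex.norm_exp _
  have hslit : ∀ w ∈ Metric.closedBall c (r * Real.exp ζ.re),
      w * Complex.exp (-ζ) ∈ Complex.slitPlane := fun w hw =>
    (norm_logBranch_sub_le hr (mem_closedBall_iff_norm.1 hw)).1
  have hmaps : Set.MapsTo (logBranch ζ) (Metric.closedBall c (r * Real.exp ζ.re)) (logStrip γ) :=
    fun w hw => himg _ (norm_logBranch_sub_le hr (mem_closedBall_iff_norm.1 hw)).2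
  have hR : 0 < r * Real.exp ζ.re := by positivity
  set P : ℂ → ℂ := fun w => ∑ k ∈ Finset.range n, PowerSeries.coeff k a * w ^ k with hP
  have hFd : DifferentiableOn ℂ (inLog f ∘ logBranch ζ) (Metric.closedBall c (r * Real.exp ζ.re)) :=
    DifferentiableOn.comp hf
      (fun w hw => (hasDerivAt_logBranch (hslit w hw)).differentiableAt.differentiableWithinAt) hmaps
  have hPd : Differentiable ℂ P := by simp only [hP]; fun_prop
  have hd : DiffContOnCl ℂ (inLog f ∘ logBranch ζ - P) (Metric.ball c (r * Real.exp ζ.re)) :=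
    (hFd.sub hPd.differentiableOn).diffContOnCl_ball subset_rfl
  have hbound : ∀ w ∈ Metric.sphere c (r * Real.exp ζ.re),
      ‖(inLog f ∘ logBranch ζ - P) w‖ ≤ K * ((1 + r) * Real.exp ζ.re) ^ n := by
    intro w hw
    have hwB := Metric.sphere_subset_closedBall hw
    have hw0 : w ≠ 0 := left_ne_zero_of_mul (Complex.slitPlane_ne_zero (hslit w hwB))
    have h1 := hK ⟨⟨logBranch ζ w⟩, hmaps hwB⟩
    have h2 : remainder f a n ⟨⟨logBranch ζ w⟩, hmaps hwB⟩ = (inLog f ∘ logBranch ζ - P) w := by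
      have h3 := inLog_apply f ⟨⟨logBranch ζ w⟩, hmaps hwB⟩
      simp only at h3
      simp only [remainder, Pi.sub_apply, Function.comp_apply, hP, h3, LogSurface.proj,
        exp_logBranch hw0]
    rw [h2] at h1
    refine h1.trans ?_
    have h4 : LogSurface.abs ⟨logBranch ζ w⟩ = ‖w‖ := by
      rw [← LogSurface.norm_proj, LogSurface.proj, exp_logBranch hw0]
    rw [h4]
    have h5 : ‖w‖ ≤ (1 + r) * Real.exp ζ.re := by
      have := norm_add_le c (w - c)
      rw [add_sub_cancel, hcn, mem_sphere_iff_norm.1 hw] at this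
      linarith
    gcongr
  have hcau := Complex.norm_iteratedDeriv_le_of_forall_mem_sphere_norm_le p hR hd hbound
  have hcball : c ∈ Metric.ball c (r * Real.exp ζ.re) := Metric.mem_ball_self hR
  have hF : ContDiffAt ℂ p (inLog f ∘ logBranch ζ) c :=
    ((hFd.mono Metric.ball_subset_closedBall).analyticAt
      (Metric.isOpen_ball.mem_nhds hcball)).contDiffAt
  have hPc : ContDiffAt ℂ p P c := hPd.contDiff.contDiffAt
  have hlog : logBranch ζ c = ζ := by
    rw [logBranch, hc, ← Complex.exp_add]; simp
  have hFp : iteratedDeriv p (inLog f ∘ logBranch ζ) c = expDeriv^[p] (inLog f) ζ := by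
    have := iteratedDeriv_comp_logBranch (isOpen_logStrip γ) Metric.isOpen_ball hf
      (fun w hw => hslit w (Metric.ball_subset_closedBall hw))
      (hmaps.mono_left Metric.ball_subset_closedBall) p hcball
    rw [this, Function.comp_apply, hlog]
  -- For `k < p` the truncated exponent `k - p` is harmless, because the descending factorial
  -- vanishes.
  have hPp : iteratedDeriv p P c = ∑ k ∈ Finset.range n, PowerSeries.coeff k a *
        ((k.descFactorial p : ℂ) * c ^ (k - p)) := by
    simp only [hP]
    rw [iteratedDeriv_fun_sum fun k _ => by fun_prop]
    refine Finset.sum_congr rfl fun k _ => ?_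
    rw [iteratedDeriv_const_mul_field, iteratedDeriv_pow]
  rw [iteratedDeriv_sub hF hPc, hFp, hPp] at hcau
  exact hcau

/-! ### From uniform expansions to bounds for the derivatives -/

/-- Restriction of functions to a smaller sector. -/
def restrictSector {γ δ : PosReal} (h : (δ : ℝ) ≤ γ) (f : Sector γ → ℂ) : Sector δ → ℂ :=
  fun z => f ⟨z.1, logStrip_mono h z.2⟩

lemma eqOn_inLog_restrictSector {γ δ : PosReal} (h : (δ : ℝ) ≤ γ) (f : Sector γ → ℂ) :
    Set.EqOn (inLog (restrictSector h f)) (inLog f) (logStrip δ) := fun ζ hζ =>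
  (inLog_apply (restrictSector h f) ⟨⟨ζ⟩, hζ⟩).trans
    (inLog_apply f ⟨⟨ζ⟩, logStrip_mono h hζ⟩).symm

lemma Holomorphic.restrictSector {γ δ : PosReal} (h : (δ : ℝ) ≤ γ) {f : Sector γ → ℂ}
    (hf : Holomorphic f) : Holomorphic (restrictSector h f) :=
  (DifferentiableOn.mono hf (logStrip_mono h)).congr (eqOn_inLog_restrictSector h f)

lemma HasUniformExpansion.restrictSector {M : PosSeq} {k γ δ : PosReal} (h : (δ : ℝ) ≤ γ)
    {f : Sector γ → ℂ} {a : PowerSeries ℂ} (hf : HasUniformExpansion M k f a) :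
    HasUniformExpansion M k (restrictSector h f) a := by
  obtain ⟨C, hC0, hC⟩ := hf
  exact ⟨C, hC0, fun p z => hC p ⟨z.1, logStrip_mono h z.2⟩⟩

lemma mem_uniformRoumieu {M : PosSeq} {γ : PosReal} {f : Sector γ → ℂ} :
    f ∈ uniformRoumieu M γ ↔ Holomorphic f ∧ ∃ a h, HasUniformExpansion M h f a := by
  simp only [uniformRoumieu, Set.mem_iUnion]
  constructor
  · rintro ⟨h, hf, a, ha⟩
    exact ⟨hf, a, h, ha⟩
  · rintro ⟨hf, a, h, ha⟩
    exact ⟨h, hf, a, ha⟩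

lemma UniformBorelSurjective.mono {M : PosSeq} {γ δ : PosReal} (h : (δ : ℝ) ≤ γ)
    (hs : UniformBorelSurjective M γ) : UniformBorelSurjective M δ := by
  intro a ha
  obtain ⟨f, hf, rfl⟩ := hs ha
  obtain ⟨hol, b, k, hb⟩ := mem_uniformRoumieu.1 hf
  rw [hb.borel_eq]
  exact ⟨restrictSector h f, mem_uniformRoumieu.2 ⟨hol.restrictSector h, b, k,
    hb.restrictSector h⟩, (hb.restrictSector h).borel_eq⟩

/-- Nontriviality makes limits at the vertex unique, so that `limUnder` in `derivAtVertex` can be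
evaluated. -/
lemma toVertex_neBot (γ : PosReal) : (toVertex γ).NeBot := by
  refine comap_neBot fun t ht => ?_
  obtain ⟨ε, hε, hεt⟩ := Metric.mem_nhds_iff.1 ht
  refine ⟨Sector.ofPos γ (ε / 2), hεt ?_⟩
  rw [Sector.abs_ofPos γ (by positivity), Metric.mem_ball, Real.dist_0_eq_abs,
    abs_of_pos (by positivity)]
  linarith

lemma tendsto_abs_toVertex (γ : PosReal) :
    Tendsto (fun z : Sector γ => z.1.abs) (toVertex γ) (𝓝 0) := tendsto_comap

lemma taylorBorel_eq {γ : PosReal} {f : Sector γ → ℂ} {a : PowerSeries ℂ}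
    (h : ∀ p, Tendsto (iterSderiv p f) (toVertex γ) (𝓝 (p.factorial * PowerSeries.coeff p a))) :
    taylorBorel f = a := by
  have := toVertex_neBot γ
  ext p
  rw [taylorBorel, PowerSeries.coeff_mk, derivAtVertex, (h p).limUnder_eq,
    mul_div_cancel_left₀ _ (by exact_mod_cast p.factorial_ne_zero)]

/-- Differentiating a remainder `p` times costs `p! / (r|z|)^p`. The remainder of order `p` then
bounds `f^(p)`, and that of order `p + 1` gives its limit at the vertex. -/
lemma UniformBorelSurjective.deriv {M : PosSeq} {γ δ : PosReal} (h : (δ : ℝ) < γ)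
    (hs : UniformBorelSurjective M γ) : DerivBorelSurjective M δ := by
  intro a ha
  obtain ⟨f, hf, rfl⟩ := hs ha
  obtain ⟨hol, a, k, hb⟩ := mem_uniformRoumieu.1 hf
  rw [hb.borel_eq]
  obtain ⟨C, hC0, hC⟩ := hb
  have hk := k.2
  -- With this choice `3r/2` is smaller than `(γ - δ)π/2`, the angular gap between the two sectors.
  set r : ℝ := min (1 / 2) ((γ - δ) * Real.pi / 4) with hr
  have hgap : 0 < ((γ : ℝ) - δ) * Real.pi := mul_pos (sub_pos.2 h) Real.pi_pos
  have hr0 : 0 < r := lt_min (by norm_num) (by positivity)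
  have hr1 : r ≤ 1 / 2 := min_le_left _ _
  have hr2 : r ≤ (γ - δ) * Real.pi / 4 := min_le_right _ _
  have hest : ∀ (n p : ℕ) (z : Sector δ),
      ‖iterSderiv p (restrictSector h.le f) z - ∑ j ∈ Finset.range n, PowerSeries.coeff j a *
        ((j.descFactorial p : ℂ) * z.1.proj ^ (j - p))‖
      ≤ p.factorial * (C * ((k : ℝ) ^ n * M n) * ((1 + r) * z.1.abs) ^ n) / (r * z.1.abs) ^ p := by
    intro n p z
    have hz : |z.1.log.im| < δ * Real.pi / 2 := z.2
    rw [iterSderiv_eq, eqOn_iterate_expDeriv (isOpen_logStrip δ)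
      (eqOn_inLog_restrictSector h.le f) p z.2]
    have hMn := M.pos' n
    exact norm_iterate_expDeriv_sub_le hol (by positivity)
      (fun z => (hC n z).trans_eq (by ring)) hr0 hr1 (by linarith) p
  refine ⟨restrictSector h.le f, ?_, taylorBorel_eq fun p => ?_⟩
  · refine Set.mem_iUnion.2 ⟨⟨k * (1 + r) / r, by positivity⟩, hol.restrictSector h.le, C,
      fun p z => ?_⟩
    have h1 := hest p p z
    have h2 : ∑ j ∈ Finset.range p, PowerSeries.coeff j a *
        ((j.descFactorial p : ℂ) * z.1.proj ^ (j - p)) = 0 :=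
      Finset.sum_eq_zero fun j hj => by
        rw [Nat.descFactorial_eq_zero_iff_lt.2 (Finset.mem_range.1 hj)]; simp
    rw [h2, sub_zero] at h1
    refine h1.trans_eq ?_
    have hz := z.1.abs_pos
    simp only [PosSeq.hat, div_pow, mul_pow]
    field_simp
  -- Using order `p + 1` leaves one power of `|z|` after cancellation, and the `p`-th derivative of
  -- the subtracted polynomial is the constant `p! a_p`.
  · have h1 : ∀ z : Sector δ,
        ‖iterSderiv p (restrictSector h.le f) z - p.factorial * PowerSeries.coeff p a‖
          ≤ p.factorial * C * ((k : ℝ) ^ (p + 1) * M (p + 1)) * (1 + r) ^ (p + 1) / r ^ p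
            * z.1.abs := by
      intro z
      have h1 := hest (p + 1) p z
      have h2 : ∑ j ∈ Finset.range p, PowerSeries.coeff j a *
          ((j.descFactorial p : ℂ) * z.1.proj ^ (j - p)) = 0 :=
        Finset.sum_eq_zero fun j hj => by
          rw [Nat.descFactorial_eq_zero_iff_lt.2 (Finset.mem_range.1 hj)]; simp
      rw [Finset.sum_range_succ, h2, zero_add, Nat.descFactorial_self, Nat.sub_self, pow_zero,
        mul_one, mul_comm (PowerSeries.coeff p a)] at h1
      refine h1.trans_eq ?_
      have hz := z.1.abs_pos
      simp only [mul_pow, pow_succ z.1.abs]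
      field_simp
    rw [tendsto_iff_norm_sub_tendsto_zero]
    refine squeeze_zero (fun _ => norm_nonneg _) h1 ?_
    simpa using (tendsto_abs_toVertex δ).const_mul
      (p.factorial * C * ((k : ℝ) ^ (p + 1) * M (p + 1)) * (1 + r) ^ (p + 1) / r ^ p)

/-! ### From bounds for the derivatives to uniform expansions -/

lemma norm_sub_le_of_norm_deriv_le_exp {u u' : ℝ → ℂ} {K : ℝ} {n : ℕ}
    (hu : ∀ x, HasDerivAt u (u' x) x)
    (hK : ∀ x, ‖u' x‖ ≤ K * ((n + 1) * Real.exp ((n + 1) * x))) {x y : ℝ} (hxy : x ≤ y) :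
    ‖u y - u x‖ ≤ K * (Real.exp ((n + 1) * y) - Real.exp ((n + 1) * x)) := by
  have hB : ∀ t : ℝ, HasDerivAt
      (fun t => K * (Real.exp ((n + 1) * t) - Real.exp ((n + 1) * x)))
      (K * ((n + 1) * Real.exp ((n + 1) * t))) t := fun t => by
    have h1 : HasDerivAt (fun t : ℝ => ((n : ℝ) + 1) * t) ((n + 1) * 1) t :=
      (hasDerivAt_id t).const_mul _
    convert! (h1.exp.sub_const (Real.exp ((n + 1) * x))).const_mul K using 1
    ring
  refine image_norm_le_of_norm_deriv_right_le_deriv_boundary (a := x) (b := y)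
    (f := fun t => u t - u x) (f' := u')
    (fun t _ => ((hu t).sub_const _).continuousAt.continuousWithinAt)
    (fun t _ => ((hu t).sub_const _).hasDerivWithinAt) ?_ hB (fun t _ => hK t)
    (Set.right_mem_Icc.2 hxy)
  simp

/-- A function on the line whose derivative is exponentially small at `-∞` is controlled by its
limit at `-∞`. -/
lemma norm_sub_le_of_tendsto_atBot {u u' : ℝ → ℂ} {K : ℝ} {n : ℕ} {l : ℂ}
    (hu : ∀ x, HasDerivAt u (u' x) x)
    (hK : ∀ x, ‖u' x‖ ≤ K * ((n + 1) * Real.exp ((n + 1) * x)))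
    (hl : Tendsto u atBot (𝓝 l)) (y : ℝ) : ‖u y - l‖ ≤ K * Real.exp ((n + 1) * y) := by
  have hK0 : 0 ≤ K := by
    have h1 := (norm_nonneg _).trans (hK 0)
    exact nonneg_of_mul_nonneg_left h1 (by positivity)
  refine le_of_tendsto ((tendsto_const_nhds.sub hl).norm) ?_
  filter_upwards [eventually_le_atBot y] with x hx
  refine (norm_sub_le_of_norm_deriv_le_exp hu hK hx).trans ?_
  gcongr
  linarith [Real.exp_pos ((n + 1) * x)]

/-- Two points of modulus at most `x` are joined by two arcs and a segment of the positive axis, of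
total length `O(x)`. A bounded `d/dz`-derivative therefore gives the Cauchy criterion at the vertex,
even when the sector winds around 0. -/
lemma exists_tendsto_toVertex {γ : PosReal} {g : ℂ → ℂ} {g' : ℂ → ℂ} {K : ℝ}
    (hg : ∀ ζ ∈ logStrip γ, HasDerivAt g (Complex.exp ζ * g' ζ) ζ)
    (hK : ∀ ζ ∈ logStrip γ, ‖g' ζ‖ ≤ K) :
    ∃ l : ℂ, Tendsto (fun z : Sector γ => g z.1.log) (toVertex γ) (𝓝 l) := by
  have hne := toVertex_neBot γ
  have hpos : 0 < (γ : ℝ) * Real.pi / 2 := by have := γ.2; positivity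
  have hreal : ∀ x : ℝ, (x : ℂ) ∈ logStrip γ := fun x => by
    rw [mem_logStrip, Complex.ofReal_im, abs_zero]; exact hpos
  have hK0 : 0 ≤ K := (norm_nonneg _).trans (hK _ (hreal 0))
  have hvert : ∀ ζ ∈ logStrip γ,
      ‖g ζ - g (ζ.re : ℂ)‖ ≤ Real.exp ζ.re * K * (γ * Real.pi / 2) := by
    intro ζ hζ
    set s : Set ℂ := {η | η ∈ logStrip γ ∧ η.re = ζ.re} with hs
    have hconv : Convex ℝ s := by
      have h1 : s = logStrip γ ∩ ({η | η.re ≤ ζ.re} ∩ {η | ζ.re ≤ η.re}) := by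
        ext η
        simp only [hs, Set.mem_ofPred_eq, Set.mem_inter_iff, le_antisymm_iff]
      rw [h1]
      exact (convex_logStrip γ).inter
        ((convex_halfSpace_re_le _).inter (convex_halfSpace_re_ge _))
    have h1 := hconv.norm_image_sub_le_of_norm_hasDerivWithin_le (f := g)
      (f' := fun η => Complex.exp η * g' η) (C := Real.exp ζ.re * K)
      (fun η hη => (hg η hη.1).hasDerivWithinAt)
      (fun η hη => by
        rw [norm_mul, Complex.norm_exp, hη.2]
        exact mul_le_mul_of_nonneg_left (hK η hη.1) (Real.exp_pos _).le)
      (x := (ζ.re : ℂ)) (y := ζ) ⟨hreal _, by simp⟩ ⟨hζ, rfl⟩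
    refine h1.trans ?_
    have h2 : ζ - (ζ.re : ℂ) = ζ.im * Complex.I := by
      apply Complex.ext <;> simp
    rw [h2, norm_mul, Complex.norm_I, mul_one, Complex.norm_real, Real.norm_eq_abs]
    gcongr
    exact (mem_logStrip.1 hζ).le
  have hhor : ∀ x y : ℝ, x ≤ y → ‖g y - g x‖ ≤ K * Real.exp y := by
    intro x y hxy
    have hu : ∀ t : ℝ, HasDerivAt (fun t : ℝ => g t) (Complex.exp t * g' t) t := fun t =>
      (hg t (hreal t)).comp_ofReal
    have h1 := norm_sub_le_of_norm_deriv_le_exp (n := 0) (K := K) hu (fun t => by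
      rw [norm_mul, Complex.norm_exp, Complex.ofReal_re, mul_comm]
      simpa using mul_le_mul_of_nonneg_right (hK t (hreal t)) (Real.exp_pos t).le) hxy
    simp only [Nat.cast_zero, zero_add, one_mul] at h1
    refine h1.trans ?_
    gcongr
    linarith [Real.exp_pos x]
  set A : ℝ := K * (γ * Real.pi / 2) + K * (γ * Real.pi / 2) + K with hA
  have hA0 : 0 ≤ A := by positivity
  have hosc : ∀ (ζ η : ℂ) (x : ℝ), ζ ∈ logStrip γ → η ∈ logStrip γ → Real.exp ζ.re ≤ x →
      Real.exp η.re ≤ x → ‖g ζ - g η‖ ≤ A * x := by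
    intro ζ η x hζ hη hζx hηx
    have h1 := (hvert ζ hζ).trans (b := Real.exp ζ.re * K * (γ * Real.pi / 2))
      (c := x * K * (γ * Real.pi / 2)) (by gcongr)
    have h2 := (hvert η hη).trans (b := Real.exp η.re * K * (γ * Real.pi / 2))
      (c := x * K * (γ * Real.pi / 2)) (by gcongr)
    have h3 : ‖g (ζ.re : ℂ) - g (η.re : ℂ)‖ ≤ K * x := by
      rcases le_total η.re ζ.re with h | h
      · exact (hhor _ _ h).trans (by gcongr)
      · rw [norm_sub_rev]
        exact (hhor _ _ h).trans (by gcongr)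
    have h4 : g ζ - g η = (g ζ - g (ζ.re : ℂ)) + (g (ζ.re : ℂ) - g (η.re : ℂ))
        - (g η - g (η.re : ℂ)) := by ring
    rw [h4]
    have h5 := norm_sub_le ((g ζ - g (ζ.re : ℂ)) + (g (ζ.re : ℂ) - g (η.re : ℂ)))
      (g η - g (η.re : ℂ))
    have h6 := norm_add_le (g ζ - g (ζ.re : ℂ)) (g (ζ.re : ℂ) - g (η.re : ℂ))
    rw [hA]
    linarith
  have hcauchy : Cauchy (map (fun z : Sector γ => g z.1.log) (toVertex γ)) := by
    rw [Metric.cauchy_iff]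
    refine ⟨hne.map _, fun ε hε => ?_⟩
    set δ : ℝ := ε / (A + 1) / 2 with hδ
    have hδ0 : 0 < δ := by positivity
    have hmem : {z : Sector γ | z.1.abs < δ} ∈ toVertex γ :=
      (tendsto_abs_toVertex γ).eventually (gt_mem_nhds hδ0)
    refine ⟨_, image_mem_map hmem, ?_⟩
    rintro _ ⟨z, hz, rfl⟩ _ ⟨w, hw, rfl⟩
    rw [dist_eq_norm]
    refine (hosc z.1.log w.1.log δ z.2 w.2 (le_of_lt hz) (le_of_lt hw)).trans_lt ?_
    have h1 : (A + 1) * δ = ε / 2 := by rw [hδ]; field_simp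
    nlinarith
  exact CompleteSpace.complete hcauchy

/-- Taylor's formula at the vertex. -/
lemma norm_sub_taylor_le {γ : PosReal} {g : ℕ → ℂ → ℂ} {B : ℕ → ℝ} {l : ℕ → ℂ}
    (hg : ∀ p, ∀ ζ ∈ logStrip γ, HasDerivAt (g p) (Complex.exp ζ * g (p + 1) ζ) ζ)
    (hB : ∀ p, ∀ ζ ∈ logStrip γ, ‖g p ζ‖ ≤ B p)
    (hl : ∀ p, Tendsto (fun z : Sector γ => g p z.1.log) (toVertex γ) (𝓝 (l p))) (p : ℕ) :
    ∀ j, ∀ ζ ∈ logStrip γ,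
      ‖g j ζ - ∑ k ∈ Finset.range p, l (j + k) / (k.factorial : ℂ) * Complex.exp ζ ^ k‖
        ≤ B (j + p) / p.factorial * Real.exp ζ.re ^ p := by
  induction p with
  | zero => intro j ζ hζ; simpa using hB j ζ hζ
  | succ p ih =>
    intro j ζ hζ
    -- The induction runs over all `j` at once: `P' = Q` is the shorter Taylor polynomial of `g (j +
    -- 1)`, so the induction hypothesis bounds the derivative of the error. The error is then
    -- integrated along a horizontal line from `-∞`, where it tends to 0.
    set P : ℂ → ℂ := fun w => ∑ k ∈ Finset.range (p + 1), l (j + k) / (k.factorial : ℂ) * w ^ k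
      with hP
    set Q : ℂ → ℂ := fun w => ∑ k ∈ Finset.range p, l (j + 1 + k) / (k.factorial : ℂ) * w ^ k
      with hQ
    have hPQ : ∀ w, HasDerivAt P (Q w) w := by
      intro w
      have h1 : HasDerivAt P (∑ k ∈ Finset.range (p + 1),
          l (j + k) / (k.factorial : ℂ) * (k * w ^ (k - 1))) w :=
        HasDerivAt.fun_sum fun k _ => (hasDerivAt_pow k w).const_mul _
      convert! h1 using 1
      rw [Finset.sum_range_succ', hQ]
      simp only [Nat.cast_zero, zero_mul, mul_zero, add_zero]
      refine Finset.sum_congr rfl fun k _ => ?_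
      have h2 : (k.factorial : ℂ) ≠ 0 := by exact_mod_cast k.factorial_ne_zero
      have h3 : ((k : ℂ) + 1) ≠ 0 := by exact_mod_cast k.succ_ne_zero
      rw [Nat.factorial_succ, show j + 1 + k = j + (k + 1) by ring]
      push_cast
      field_simp
    have hline : ∀ t : ℝ, (t : ℂ) + ζ.im * Complex.I ∈ logStrip γ := fun t => by
      rw [mem_logStrip]; simpa using mem_logStrip.1 hζ
    have hre : ∀ t : ℝ, ((t : ℂ) + ζ.im * Complex.I).re = t := fun t => by simp
    set u : ℝ → ℂ := fun t => g j (t + ζ.im * Complex.I)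
      - P (Complex.exp (t + ζ.im * Complex.I)) with hu
    set u' : ℝ → ℂ := fun t => Complex.exp (t + ζ.im * Complex.I) *
      (g (j + 1) (t + ζ.im * Complex.I) - Q (Complex.exp (t + ζ.im * Complex.I))) with hu'
    have hderiv : ∀ t, HasDerivAt u (u' t) t := by
      intro t
      have h1 : HasDerivAt (fun η : ℂ => η + ζ.im * Complex.I) 1 (t : ℂ) :=
        (hasDerivAt_id _).add_const _
      have h2 := HasDerivAt.comp (t : ℂ) (hg j _ (hline t)) h1
      have h3 := HasDerivAt.comp (t : ℂ) (hPQ (Complex.exp (t + ζ.im * Complex.I))) h1.cexp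
      convert! (h2.sub h3).comp_ofReal using 1
      simp only [hu']
      ring
    have hbd : ∀ t, ‖u' t‖ ≤ B (j + (p + 1)) / (p + 1).factorial *
        ((p + 1) * Real.exp ((p + 1) * t)) := by
      intro t
      rw [hu', norm_mul, Complex.norm_exp, hre]
      have h1 := ih (j + 1) _ (hline t)
      rw [hre, show j + 1 + p = j + (p + 1) by ring] at h1
      refine (mul_le_mul_of_nonneg_left h1 (Real.exp_pos t).le).trans_eq ?_
      have h2 : Real.exp (((p : ℝ) + 1) * t) = Real.exp t ^ p * Real.exp t := by
        rw [← pow_succ, ← Real.exp_nat_mul]; push_cast; rfl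
      have h4 : (p.factorial : ℝ) ≠ 0 := by exact_mod_cast p.factorial_ne_zero
      rw [h2, Nat.factorial_succ]
      push_cast
      field_simp
    have hvert : Tendsto (fun t : ℝ => (⟨⟨t + ζ.im * Complex.I⟩, hline t⟩ : Sector γ)) atBot
        (toVertex γ) := by
      rw [toVertex, tendsto_comap_iff]
      have : (fun z : Sector γ => z.1.abs) ∘
          (fun t : ℝ => (⟨⟨t + ζ.im * Complex.I⟩, hline t⟩ : Sector γ)) = Real.exp := by
        funext t
        simp [LogSurface.abs]
      rw [this]
      exact Real.tendsto_exp_atBot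
    have hlim : Tendsto u atBot (𝓝 0) := by
      have h1 := (hl j).comp hvert
      have h2 : Tendsto (fun t : ℝ => Complex.exp (t + ζ.im * Complex.I)) atBot (𝓝 0) := by
        rw [tendsto_zero_iff_norm_tendsto_zero]
        simp only [Complex.norm_exp, hre]
        exact Real.tendsto_exp_atBot
      have h3 := ((hPQ 0).continuousAt.tendsto).comp h2
      have h4 : P 0 = l j := by simp [hP, Finset.sum_range_succ']
      have h5 := h1.sub h3
      rw [h4, sub_self] at h5
      exact h5
    have hfin := norm_sub_le_of_tendsto_atBot hderiv hbd hlim ζ.re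
    have h6 : (ζ.re : ℂ) + ζ.im * Complex.I = ζ := Complex.re_add_im ζ
    rw [sub_zero, hu] at hfin
    simp only [h6] at hfin
    refine hfin.trans_eq ?_
    rw [← Real.exp_nat_mul]
    push_cast
    rfl

/-- The `p!` in the bounds for the derivatives cancels the `1/p!` of Taylor's formula, so the same
function works, with the same type `h`. -/
lemma DerivBorelSurjective.uniform {M : PosSeq} {γ : PosReal}
    (hs : DerivBorelSurjective M γ) : UniformBorelSurjective M γ := by
  intro a ha
  obtain ⟨f, hf, rfl⟩ := hs ha
  obtain ⟨h, hol, C, hC⟩ := Set.mem_iUnion.1 hf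
  have hh := h.2
  have hg : ∀ p, ∀ ζ ∈ logStrip γ, HasDerivAt (expDeriv^[p] (inLog f))
      (Complex.exp ζ * expDeriv^[p + 1] (inLog f) ζ) ζ := fun p ζ hζ =>
    hasDerivAt_iterate_expDeriv (isOpen_logStrip γ) hol p hζ
  have hB : ∀ p, ∀ ζ ∈ logStrip γ,
      ‖expDeriv^[p] (inLog f) ζ‖ ≤ (|C| + 1) * ((h : ℝ) ^ p * M.hat p) := fun p ζ hζ => by
    have h1 := hC p ⟨⟨ζ⟩, hζ⟩
    rw [iterSderiv_eq] at h1
    have h2 := M.hat.pos' p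
    refine h1.trans ?_
    gcongr
    linarith [le_abs_self C]
  have hex := fun p => exists_tendsto_toVertex (hg p) (hB (p + 1))
  choose l hl using hex
  have := toVertex_neBot γ
  have htaylor : ∀ p, PowerSeries.coeff p (taylorBorel f) = l p / p.factorial := fun p => by
    have h1 : iterSderiv p f = fun z : Sector γ => expDeriv^[p] (inLog f) z.1.log :=
      funext fun z => iterSderiv_eq f p z
    rw [taylorBorel, PowerSeries.coeff_mk, derivAtVertex, h1, (hl p).limUnder_eq]
  have hexp : HasUniformExpansion M h f (taylorBorel f) := by
    refine ⟨|C| + 1, by positivity, fun p z => ?_⟩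
    have h1 := norm_sub_taylor_le hg hB hl p 0 z.1.log z.2
    simp only [zero_add, Function.iterate_zero, id, inLog_apply] at h1
    simp only [remainder, htaylor]
    refine h1.trans_eq ?_
    have h4 : (p.factorial : ℝ) ≠ 0 := by exact_mod_cast p.factorial_ne_zero
    simp only [PosSeq.hat, LogSurface.abs]
    field_simp
  exact ⟨f, mem_uniformRoumieu.2 ⟨hol, _, h, hexp⟩, hexp.borel_eq⟩

/-! ### The kernel -/

/-- The derivative `1/(1 + v)` has modulus at most 1 on the convex half-plane `Re v ≥ 0`. -/
lemma norm_log_one_add_le_of_re_nonneg {w : ℂ} (hw : 0 ≤ w.re) : ‖Complex.log (1 + w)‖ ≤ ‖w‖ := by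
  have hslit : ∀ v : ℂ, 0 ≤ v.re → 1 + v ∈ Complex.slitPlane := fun v hv =>
    Or.inl (by simp only [Complex.add_re, Complex.one_re]; linarith)
  have h := (convex_halfSpace_re_ge 0).norm_image_sub_le_of_norm_hasDerivWithin_le
    (f := fun v : ℂ => Complex.log (1 + v)) (f' := fun v => 1 / (1 + v)) (C := 1)
    (x := 0) (y := w)
    (fun v hv => (((hasDerivAt_id v).const_add 1).clog (hslit v hv)).hasDerivWithinAt)
    (fun v hv => by
      have h1 : 0 ≤ v.re := hv
      have h2 : 1 ≤ ‖1 + v‖ := by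
        refine le_trans ?_ (Complex.re_le_norm _)
        simp only [Complex.add_re, Complex.one_re]
        linarith
      rw [norm_div, norm_one]
      exact div_le_one_of_le₀ h2 (norm_nonneg _))
    (show (0 : ℝ) ≤ (0 : ℂ).re from le_rfl) hw
  simpa using h

/-- In the right half-plane `|1 + w|` dominates both 1 and `|w|`; this is the source of the decay of
the kernel. -/
lemma max_log_le_re_log_one_add {w : ℂ} (hw : 0 ≤ w.re) (hw0 : w ≠ 0) :
    max 0 (Real.log ‖w‖) ≤ (Complex.log (1 + w)).re := by
  have h2 : 1 ≤ ‖1 + w‖ := by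
    refine le_trans ?_ (Complex.re_le_norm _)
    simp only [Complex.add_re, Complex.one_re]
    linarith
  have h3 : ‖w‖ ≤ ‖1 + w‖ := by
    rw [← sq_le_sq₀ (norm_nonneg _) (norm_nonneg _), Complex.sq_norm, Complex.sq_norm,
      Complex.normSq_apply, Complex.normSq_apply]
    simp only [Complex.add_re, Complex.one_re, Complex.add_im, Complex.one_im]
    nlinarith
  rw [Complex.log_re]
  exact max_le (Real.log_nonneg h2) (Real.log_le_log (norm_pos_iff.2 hw0) h3)

/-- The variable `(e^ζ / e^l) ^ (1 / α)`. -/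
noncomputable def kernelVar (α : PosReal) (l : ℝ) (ζ : ℂ) : ℂ :=
  Complex.exp ((ζ - l) / (α : ℝ))

/-- The kernel `∏ (1 + (z / m_p) ^ (1 / α)) ^ (-α)` in the coordinate `ζ = log z`, where
`lm p = log m_p`. -/
noncomputable def kernel (α : PosReal) (lm : ℕ → ℝ) (ζ : ℂ) : ℂ :=
  Complex.exp (-(α : ℝ) * ∑' p, Complex.log (1 + kernelVar α (lm p) ζ))

lemma norm_kernelVar (α : PosReal) (l : ℝ) (ζ : ℂ) :
    ‖kernelVar α l ζ‖ = Real.exp ((ζ.re - l) / α) := by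
  rw [kernelVar, Complex.norm_exp, Complex.div_ofReal_re, Complex.sub_re, Complex.ofReal_re]

lemma kernelVar_re_pos {α : PosReal} (l : ℝ) {ζ : ℂ} (hζ : ζ ∈ logStrip α) :
    0 < (kernelVar α l ζ).re := by
  have hα := α.2
  rw [kernelVar, Complex.exp_re]
  refine mul_pos (Real.exp_pos _) (Real.cos_pos_of_mem_Ioo ?_)
  rw [Complex.div_ofReal_im, Complex.sub_im, Complex.ofReal_im, sub_zero]
  have h1 := abs_lt.1 (mem_logStrip.1 hζ)
  constructor
  · rw [lt_div_iff₀ hα]; linarith [h1.1]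
  · rw [div_lt_iff₀ hα]; linarith [h1.2]

section

variable {α : PosReal} {lm : ℕ → ℝ}

lemma norm_log_kernelVar_le (p : ℕ) {ζ : ℂ} (hζ : ζ ∈ logStrip α) :
    ‖Complex.log (1 + kernelVar α (lm p) ζ)‖ ≤ Real.exp (ζ.re / α) * Real.exp (-lm p / α) := by
  refine (norm_log_one_add_le_of_re_nonneg (kernelVar_re_pos _ hζ).le).trans_eq ?_
  rw [norm_kernelVar, ← Real.exp_add]
  ring_nf

lemma summable_log_kernelVar (hsum : Summable fun p => Real.exp (-lm p / α)) {ζ : ℂ}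
    (hζ : ζ ∈ logStrip α) : Summable fun p => Complex.log (1 + kernelVar α (lm p) ζ) :=
  Summable.of_norm_bounded (hsum.mul_left _) fun p => norm_log_kernelVar_le p hζ

lemma differentiableOn_kernel (hsum : Summable fun p => Real.exp (-lm p / α)) :
    DifferentiableOn ℂ (kernel α lm) (logStrip α) := by
  intro ζ hζ
  have hα := α.2
  -- The majorant of the series grows with the real part, so the Weierstrass test is applied on a
  -- half-strip.
  set U : Set ℂ := logStrip α ∩ {η | η.re < ζ.re + 1} with hU
  have hUo : IsOpen U := (isOpen_logStrip α).inter
    (isOpen_lt Complex.continuous_re continuous_const)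
  have hmem : ζ ∈ U := ⟨hζ, by simp⟩
  have h1 : DifferentiableOn ℂ (fun η => ∑' p, Complex.log (1 + kernelVar α (lm p) η)) U := by
    refine Complex.differentiableOn_tsum_of_summable_norm
      (hsum.mul_left (Real.exp ((ζ.re + 1) / α))) (fun p η hη => ?_) hUo fun p η hη => ?_
    · have h2 : DifferentiableAt ℂ (fun η => 1 + kernelVar α (lm p) η) η := by
        unfold kernelVar; fun_prop
      refine (h2.clog (Or.inl ?_)).differentiableWithinAt
      have := kernelVar_re_pos (lm p) hη.1
      simp only [Complex.add_re, Complex.one_re]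
      linarith
    · refine (norm_log_kernelVar_le p hη.1).trans ?_
      have h3 : η.re < ζ.re + 1 := hη.2
      gcongr
  exact ((h1.differentiableAt (hUo.mem_nhds hmem)).const_mul _).cexp.differentiableWithinAt

/-- The partial sums `log (m_0 ⋯ m_{k-1})`. -/
noncomputable def logSum (lm : ℕ → ℝ) (k : ℕ) : ℝ := ∑ p ∈ Finset.range k, lm p

lemma logSum_succ (lm : ℕ → ℝ) (k : ℕ) : logSum lm (k + 1) = logSum lm k + lm k :=
  Finset.sum_range_succ _ _

/-- Each factor of the product has modulus at most `min(1, m_p/|z|)`, the exponents `α` and `1/α`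
cancelling. Keeping the first `k` factors gives `M_k / |z|^k`. -/
lemma norm_kernel_le (hsum : Summable fun p => Real.exp (-lm p / α)) {ζ : ℂ}
    (hζ : ζ ∈ logStrip α) (k : ℕ) :
    ‖kernel α lm ζ‖ ≤ Real.exp (logSum lm k - k * ζ.re) := by
  have hα := α.2
  have hs := summable_log_kernelVar hsum hζ
  have hpos : ∀ p, max 0 ((ζ.re - lm p) / α) ≤ (Complex.log (1 + kernelVar α (lm p) ζ)).re := by
    intro p
    have h1 := max_log_le_re_log_one_add (kernelVar_re_pos (lm p) hζ).le (Complex.exp_ne_zero _)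
    rwa [norm_kernelVar, Real.log_exp] at h1
  rw [kernel, Complex.norm_exp, ← Complex.ofReal_neg, Complex.re_ofReal_mul, Complex.re_tsum hs]
  refine Real.exp_le_exp.2 ?_
  have h2 : ∑ p ∈ Finset.range k, (ζ.re - lm p) / α
      ≤ ∑' p, (Complex.log (1 + kernelVar α (lm p) ζ)).re :=
    (Finset.sum_le_sum fun p _ => (le_max_right _ _).trans (hpos p)).trans
      (Summable.sum_le_tsum _ (fun p _ => (le_max_left _ _).trans (hpos p))
        (Complex.hasSum_re hs.hasSum).summable)
  rw [← Finset.sum_div, div_le_iff₀ hα, Finset.sum_sub_distrib, Finset.sum_const,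
    Finset.card_range, nsmul_eq_mul] at h2
  rw [logSum]
  linarith

/-! ### The kernel on the real line -/

/-- The restriction of the kernel to the real line. -/
noncomputable def realKernel (α : PosReal) (lm : ℕ → ℝ) (s : ℝ) : ℝ :=
  Real.exp (-α * ∑' p, Real.log (1 + Real.exp ((s - lm p) / α)))

lemma log_one_add_exp_le (x : ℝ) : Real.log (1 + Real.exp x) ≤ Real.exp x := by
  have := Real.log_le_sub_one_of_pos (x := 1 + Real.exp x) (by positivity)
  linarith

lemma log_one_add_exp_nonneg (x : ℝ) : 0 ≤ Real.log (1 + Real.exp x) :=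
  Real.log_nonneg (by linarith [Real.exp_pos x])

lemma summable_log_one_add_exp (hsum : Summable fun p => Real.exp (-lm p / α)) (s : ℝ) :
    Summable fun p => Real.log (1 + Real.exp ((s - lm p) / α)) := by
  refine Summable.of_nonneg_of_le (fun p => log_one_add_exp_nonneg _)
    (fun p => ?_) (hsum.mul_left (Real.exp (s / α)))
  refine (log_one_add_exp_le _).trans_eq ?_
  rw [← Real.exp_add]
  ring_nf

lemma kernel_ofReal (s : ℝ) : kernel α lm s = realKernel α lm s := by
  have h1 : ∀ p, Complex.log (1 + kernelVar α (lm p) s)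
      = ((Real.log (1 + Real.exp ((s - lm p) / α)) : ℝ) : ℂ) := by
    intro p
    rw [Complex.ofReal_log (by positivity), kernelVar]
    push_cast
    rfl
  simp only [kernel, realKernel, h1]
  push_cast
  rfl

lemma antitone_realKernel (hsum : Summable fun p => Real.exp (-lm p / α)) :
    Antitone (realKernel α lm) := by
  intro s t hst
  have hα := α.2
  have h1 : ∑' p, Real.log (1 + Real.exp ((s - lm p) / α))
      ≤ ∑' p, Real.log (1 + Real.exp ((t - lm p) / α)) :=
    Summable.tsum_le_tsum (fun p => Real.log_le_log (by positivity) (by gcongr))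
      (summable_log_one_add_exp hsum s) (summable_log_one_add_exp hsum t)
  refine Real.exp_le_exp.2 ?_
  nlinarith

/-- A lower bound for the kernel at `m_k`. -/
lemma realKernel_ge (hsum : Summable fun p => Real.exp (-lm p / α)) (hmono : Monotone lm)
    {D : ℝ} {k : ℕ} (hD : ∑' j, Real.exp ((lm k - lm (j + k)) / α) ≤ D)
    (hDs : Summable fun j => Real.exp ((lm k - lm (j + k)) / α)) :
    Real.exp (logSum lm k - k * lm k - α * (k * Real.log 2 + D)) ≤ realKernel α lm (lm k) := by
  have hα := α.2
  refine Real.exp_le_exp.2 ?_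
  have hs := summable_log_one_add_exp hsum (lm k)
  -- For `p < k` the exponent `x` is nonnegative and `log(1 + e^x) ≤ log 2 + x`; for `p ≥ k` one
  -- uses `log(1 + e^x) ≤ e^x` and the bound `D` on the tail.
  have h1 : ∑ p ∈ Finset.range k, Real.log (1 + Real.exp ((lm k - lm p) / α))
      ≤ ∑ p ∈ Finset.range k, (Real.log 2 + (lm k - lm p) / α) := by
    refine Finset.sum_le_sum fun p hp => ?_
    have h2 : 0 ≤ (lm k - lm p) / α :=
      div_nonneg (sub_nonneg.2 (hmono (Finset.mem_range.1 hp).le)) hα.le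
    have h3 : 1 + Real.exp ((lm k - lm p) / α) ≤ 2 * Real.exp ((lm k - lm p) / α) := by
      have := Real.one_le_exp h2
      linarith
    refine (Real.log_le_log (by positivity) h3).trans_eq ?_
    rw [Real.log_mul (by norm_num) (Real.exp_pos _).ne', Real.log_exp]
  have h4 : ∑' j, Real.log (1 + Real.exp ((lm k - lm (j + k)) / α)) ≤ D :=
    (Summable.tsum_le_tsum (fun j => log_one_add_exp_le _) ((summable_nat_add_iff k).2 hs)
      hDs).trans hD
  have h5 := hs.sum_add_tsum_nat_add k
  rw [← h5]
  rw [Finset.sum_add_distrib, ← Finset.sum_div, Finset.sum_sub_distrib, Finset.sum_const,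
    Finset.sum_const, Finset.card_range, nsmul_eq_mul, nsmul_eq_mul] at h1
  have h6 : (α : ℝ) * ((k * lm k - ∑ p ∈ Finset.range k, lm p) / α)
      = k * lm k - ∑ p ∈ Finset.range k, lm p := mul_div_cancel₀ _ hα.ne'
  have h7 := mul_le_mul_of_nonneg_left (add_le_add h1 h4) hα.le
  rw [logSum]
  nlinarith

end

/-! ### Tails of convergent power sums -/

/-- This is the integral comparison for `∑_{p ≥ k} ((k+1)/(p+1))^θ`. What matters is that the bound
is linear in `k + 1`. -/
lemma sum_range_exp_log_le {θ : ℝ} (hθ : 1 < θ) (k n : ℕ) :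
    ∑ j ∈ Finset.range n, Real.exp (θ * (Real.log (k + 1) - Real.log ((j + k : ℕ) + 1)))
      ≤ (k + 1) * (1 + 1 / (θ - 1)) := by
  have hθ' : 0 < θ - 1 := sub_pos.2 hθ
  -- The right side is 1 plus the integral of `((k+1)/x)^θ` from `k + 1` to `n + k + 1`, in closed
  -- form so that the induction closes.
  have key : ∀ n : ℕ, ∑ j ∈ Finset.range (n + 1),
      Real.exp (θ * (Real.log (k + 1) - Real.log ((j + k : ℕ) + 1)))
      ≤ 1 + (k + 1) / (θ - 1) *
        (1 - Real.exp ((θ - 1) * (Real.log (k + 1) - Real.log ((n + k : ℕ) + 1)))) := by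
    intro n
    induction n with
    | zero => simp
    | succ n ih =>
      rw [Finset.sum_range_succ]
      set x : ℝ := ((n + 1 + k : ℕ) : ℝ) + 1 with hx
      have hx1 : ((n + k : ℕ) : ℝ) + 1 = x - 1 := by rw [hx]; push_cast; ring
      have hx2 : 1 < x := by
        rw [hx]
        have : (0 : ℝ) < ((n + 1 + k : ℕ) : ℝ) := by positivity
        linarith
      rw [hx1] at ih
      set y : ℝ := Real.log (k + 1) with hy
      have hk : Real.exp y = k + 1 := Real.exp_log (by positivity)
      have hlog : Real.log (x - 1) ≤ Real.log x - 1 / x := by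
        have h1 : x - 1 = x * (1 - 1 / x) := by field_simp
        have h2 : 0 < 1 - 1 / x := by
          have : 1 / x < 1 := (div_lt_one (by linarith)).2 hx2
          linarith
        rw [h1, Real.log_mul (by linarith) h2.ne']
        have := Real.log_le_sub_one_of_pos h2
        linarith
      have h3 : Real.exp ((θ - 1) * (y - Real.log x)) * (1 + (θ - 1) / x)
          ≤ Real.exp ((θ - 1) * (y - Real.log (x - 1))) := by
        have h4 : 1 + (θ - 1) / x ≤ Real.exp ((θ - 1) / x) := by
          have := Real.add_one_le_exp ((θ - 1) / x)
          linarith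
        calc _ ≤ Real.exp ((θ - 1) * (y - Real.log x)) * Real.exp ((θ - 1) / x) := by gcongr
          _ = Real.exp ((θ - 1) * (y - (Real.log x - 1 / x))) := by
            rw [← Real.exp_add]; ring_nf
          _ ≤ _ := by gcongr
      have h5 : Real.exp (θ * (y - Real.log x))
          = (k + 1) / x * Real.exp ((θ - 1) * (y - Real.log x)) := by
        have h6 : θ * (y - Real.log x) = y - Real.log x + (θ - 1) * (y - Real.log x) := by ring
        rw [h6, Real.exp_add, Real.exp_sub, hk, Real.exp_log (by linarith)]
      rw [h5]
      have hx0 : 0 < x := by linarith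
      have h7 : (k + 1) / x * Real.exp ((θ - 1) * (y - Real.log x))
          = ((k : ℝ) + 1) / (θ - 1) * (Real.exp ((θ - 1) * (y - Real.log x)) * ((θ - 1) / x)) := by
        field_simp
      rw [h7]
      have h8 : (0 : ℝ) ≤ ((k : ℝ) + 1) / (θ - 1) := by positivity
      nlinarith
  rcases n with _ | n
  · simp only [Finset.range_zero, Finset.sum_empty]
    positivity
  · refine (key n).trans ?_
    have h1 : (0 : ℝ) ≤ ((k : ℝ) + 1) / (θ - 1) := by positivity
    have h2 := Real.exp_pos ((θ - 1) * (Real.log (k + 1) - Real.log ((n + k : ℕ) + 1)))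
    have h3 : ((k : ℝ) + 1) * (1 + 1 / (θ - 1)) = (k + 1) + (k + 1) / (θ - 1) := by ring
    rw [h3]
    have h4 : (0 : ℝ) ≤ k := k.cast_nonneg
    nlinarith

/-- Growth `m_k / (k + 1) ^ β ≤ e^a m_p / (p + 1) ^ β` for `k ≤ p`, in terms of logarithms. -/
def LogAlmostIncreasing (lm : ℕ → ℝ) (β a : ℝ) : Prop :=
  ∀ k p : ℕ, k ≤ p → lm k - lm p ≤ a + β * (Real.log (k + 1) - Real.log (p + 1))

/-- Taking the power `1/α` of the growth condition leaves the exponent `β/α > 1`. Linearity in `k +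
1` turns into a geometric factor when the tail is exponentiated in the kernel. -/
lemma LogAlmostIncreasing.tail {lm : ℕ → ℝ} {β a : ℝ} (h : LogAlmostIncreasing lm β a)
    {α : PosReal} (hαβ : (α : ℝ) < β) (k : ℕ) :
    (Summable fun j => Real.exp ((lm k - lm (j + k)) / α)) ∧
    ∑' j, Real.exp ((lm k - lm (j + k)) / α)
      ≤ Real.exp (a / α) * (1 + 1 / (β / α - 1)) * (k + 1) := by
  have hα := α.2
  have hθ : 1 < β / α := (one_lt_div hα).2 hαβ
  have hpart : ∀ n, ∑ j ∈ Finset.range n, Real.exp ((lm k - lm (j + k)) / α)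
      ≤ Real.exp (a / α) * (1 + 1 / (β / α - 1)) * (k + 1) := by
    intro n
    calc _ ≤ ∑ j ∈ Finset.range n, Real.exp (a / α) *
          Real.exp (β / α * (Real.log (k + 1) - Real.log ((j + k : ℕ) + 1))) := by
          refine Finset.sum_le_sum fun j _ => ?_
          rw [← Real.exp_add]
          refine Real.exp_le_exp.2 ?_
          refine (div_le_div_of_nonneg_right (h k (j + k) (Nat.le_add_left _ _)) hα.le).trans_eq ?_
          ring
      _ = Real.exp (a / α) * ∑ j ∈ Finset.range n,
          Real.exp (β / α * (Real.log (k + 1) - Real.log ((j + k : ℕ) + 1))) := by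
          rw [Finset.mul_sum]
      _ ≤ Real.exp (a / α) * ((k + 1) * (1 + 1 / (β / α - 1))) := by
          gcongr
          exact sum_range_exp_log_le hθ k n
      _ = _ := by ring
  exact ⟨summable_of_sum_range_le (fun _ => (Real.exp_pos _).le) hpart,
    Real.tsum_le_of_sum_range_le (fun _ => (Real.exp_pos _).le) hpart⟩

lemma LogAlmostIncreasing.summable {lm : ℕ → ℝ} {β a : ℝ} (h : LogAlmostIncreasing lm β a)
    {α : PosReal} (hαβ : (α : ℝ) < β) : Summable fun p => Real.exp (-lm p / α) := by
  have h1 := (h.tail hαβ 0).1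
  refine (h1.mul_left (Real.exp (-lm 0 / α))).congr fun p => ?_
  rw [← Real.exp_add, add_zero]
  ring_nf

/-! ### The envelope of the kernel and its moments -/

/-- Split at `l₁` and `l₂`: each exponential tail contributes `e^c`, and the plateau between them
`e^c (l₂ - l₁)`. -/
lemma integrable_and_integral_le_of_exp_bounds {v : ℝ → ℝ} (hv : AEStronglyMeasurable v volume)
    (hv0 : ∀ t, 0 ≤ v t) {c l₁ l₂ : ℝ} (hl : l₁ ≤ l₂) (h₁ : ∀ t, v t ≤ Real.exp (c + (t - l₁)))
    (h₂ : ∀ t, v t ≤ Real.exp c) (h₃ : ∀ t, v t ≤ Real.exp (c - (t - l₂))) :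
    Integrable v ∧ ∫ t, v t ≤ Real.exp c * (2 + (l₂ - l₁)) := by
  have e₁ : ∀ t, Real.exp (c + (t - l₁)) = Real.exp (c - l₁) * Real.exp t := fun t => by
    rw [← Real.exp_add]; ring_nf
  have e₃ : ∀ t, Real.exp (c - (t - l₂)) = Real.exp (c + l₂) * Real.exp (-t) := fun t => by
    rw [← Real.exp_add]; ring_nf
  have i₁ : IntegrableOn (fun t => Real.exp (c + (t - l₁))) (Set.Iic l₁) := by
    simp only [e₁]
    exact (integrableOn_exp_Iic l₁).const_mul _
  have i₂ : IntegrableOn (fun _ : ℝ => Real.exp c) (Set.Ioc l₁ l₂) := by simp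
  have i₃ : IntegrableOn (fun t => Real.exp (c - (t - l₂))) (Set.Ioi l₂) := by
    simp only [e₃]
    exact (exp_neg_integrableOn_Ioi l₂ one_pos |>.congr_fun (fun t _ => by simp)
      measurableSet_Ioi).const_mul _
  have nv : ∀ t, ‖v t‖ = v t := fun t => Real.norm_of_nonneg (hv0 t)
  have j₁ : IntegrableOn v (Set.Iic l₁) :=
    i₁.mono' hv.restrict (ae_of_all _ fun t => by rw [nv]; exact h₁ t)
  have j₂ : IntegrableOn v (Set.Ioc l₁ l₂) :=
    i₂.mono' hv.restrict (ae_of_all _ fun t => by rw [nv]; exact h₂ t)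
  have j₃ : IntegrableOn v (Set.Ioi l₂) :=
    i₃.mono' hv.restrict (ae_of_all _ fun t => by rw [nv]; exact h₃ t)
  have j₂₃ : IntegrableOn v (Set.Ioi l₁) := by
    rw [← Set.Ioc_union_Ioi_eq_Ioi hl]
    exact j₂.union j₃
  have j : Integrable v := by
    rw [← integrableOn_univ, ← Set.Iic_union_Ioi (a := l₁)]
    exact j₁.union j₂₃
  refine ⟨j, ?_⟩
  have s₁ : ∫ t, v t = (∫ t in Set.Iic l₁, v t) + ∫ t in Set.Ioi l₁, v t :=
    (intervalIntegral.integral_Iic_add_Ioi j₁ j₂₃).symm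
  have s₂ : ∫ t in Set.Ioi l₁, v t = (∫ t in Set.Ioc l₁ l₂, v t) + ∫ t in Set.Ioi l₂, v t := by
    rw [← setIntegral_union (Set.Ioc_disjoint_Ioi le_rfl) measurableSet_Ioi j₂ j₃,
      Set.Ioc_union_Ioi_eq_Ioi hl]
  have b₁ : ∫ t in Set.Iic l₁, v t ≤ Real.exp c := by
    refine (setIntegral_mono j₁ i₁ h₁).trans_eq ?_
    simp only [e₁]
    rw [integral_const_mul, integral_exp_Iic, ← Real.exp_add, sub_add_cancel]
  have b₂ : ∫ t in Set.Ioc l₁ l₂, v t ≤ Real.exp c * (l₂ - l₁) := by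
    refine (setIntegral_mono j₂ i₂ h₂).trans_eq ?_
    rw [setIntegral_const, Real.volume_real_Ioc_of_le hl, smul_eq_mul, mul_comm]
  have b₃ : ∫ t in Set.Ioi l₂, v t ≤ Real.exp c := by
    refine (setIntegral_mono j₃ i₃ h₃).trans_eq ?_
    simp only [e₃]
    rw [integral_const_mul, integral_exp_neg_Ioi, ← Real.exp_add, add_neg_cancel_right]
  rw [s₁, s₂]
  linarith

/-- A bound for the kernel, adapted to the moment of order `k + 1`. -/
noncomputable def envelope (lm : ℕ → ℝ) (k : ℕ) (t : ℝ) : ℝ :=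
  min (Real.exp (logSum lm k - k * t)) (min (Real.exp (logSum lm (k + 1) - (k + 1) * t))
    (Real.exp (logSum lm (k + 2) - (k + 2) * t)))

lemma envelope_pos (lm : ℕ → ℝ) (k : ℕ) (t : ℝ) : 0 < envelope lm k t :=
  lt_min (Real.exp_pos _) (lt_min (Real.exp_pos _) (Real.exp_pos _))

lemma antitone_envelope (lm : ℕ → ℝ) (k : ℕ) : Antitone (envelope lm k) := fun s t hst => by
  unfold envelope
  gcongr

lemma continuous_envelope (lm : ℕ → ℝ) (k : ℕ) : Continuous (envelope lm k) := by
  unfold envelope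
  fun_prop

/-- After multiplication by `e^((k+1)t)` the three bounds become `M_(k+1)` times `e^t/m_k`, `1` and
`m_(k+1)/e^t`. The plateau has length `log(m_(k+1)/m_k)`, the quantity controlled by (sm). -/
lemma integral_envelope {lm : ℕ → ℝ} (hmono : Monotone lm) (k : ℕ) :
    Integrable (fun t => envelope lm k t * Real.exp ((k + 1) * t)) ∧
    ∫ t, envelope lm k t * Real.exp ((k + 1) * t)
      ≤ Real.exp (logSum lm (k + 1)) * (2 + (lm (k + 1) - lm k)) := by
  have hs₁ := logSum_succ lm k
  have hs₂ := logSum_succ lm (k + 1)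
  refine integrable_and_integral_le_of_exp_bounds
    ((continuous_envelope lm k).mul (by fun_prop)).aestronglyMeasurable
    (fun t => mul_nonneg (envelope_pos lm k t).le (Real.exp_pos _).le) (hmono k.le_succ)
    (fun t => ?_) (fun t => ?_) (fun t => ?_)
  · refine (mul_le_mul_of_nonneg_right (min_le_left _ _) (Real.exp_pos _).le).trans_eq ?_
    rw [← Real.exp_add]
    congr 1
    linarith
  · refine (mul_le_mul_of_nonneg_right ((min_le_right _ _).trans (min_le_left _ _))
      (Real.exp_pos _).le).trans_eq ?_
    rw [← Real.exp_add]
    congr 1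
    linarith
  · refine (mul_le_mul_of_nonneg_right ((min_le_right _ _).trans (min_le_right _ _))
      (Real.exp_pos _).le).trans_eq ?_
    rw [← Real.exp_add]
    congr 1
    rw [show k + 2 = k + 1 + 1 from rfl, hs₂]
    ring

lemma integral_envelope_translate {lm : ℕ → ℝ} (hmono : Monotone lm) (k : ℕ) (x : ℝ) :
    Integrable (fun s => envelope lm k (s - x) * Real.exp ((k + 1) * s)) ∧
    ∫ s, envelope lm k (s - x) * Real.exp ((k + 1) * s)
      ≤ Real.exp x ^ (k + 1) *
        (Real.exp (logSum lm (k + 1)) * (2 + (lm (k + 1) - lm k))) := by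
  obtain ⟨h1, h2⟩ := integral_envelope hmono k
  have h3 : (fun s => envelope lm k (s - x) * Real.exp ((k + 1) * s)) = fun s =>
      Real.exp x ^ (k + 1) * (envelope lm k (s - x) * Real.exp ((k + 1) * (s - x))) := by
    funext s
    rw [← Real.exp_nat_mul, mul_left_comm, ← Real.exp_add]
    push_cast
    ring_nf
  rw [h3]
  refine ⟨(h1.comp_sub_right x).const_mul _, ?_⟩
  rw [integral_const_mul,
    integral_sub_right_eq_self (fun t => envelope lm k t * Real.exp ((k + 1) * t)) x]
  gcongr

/-! ### Integral transforms with the kernel -/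

/-- The transform `∫ e(u / z) ψ(u) du / u` in logarithmic coordinates. -/
noncomputable def kernelTransform (α : PosReal) (lm : ℕ → ℝ) (ψ : ℝ → ℂ) (ζ : ℂ) : ℂ :=
  ∫ s : ℝ, kernel α lm (s - ζ) * ψ s

section

variable {α : PosReal} {lm : ℕ → ℝ}

lemma norm_kernel_le_envelope (hsum : Summable fun p => Real.exp (-lm p / α)) {ζ : ℂ}
    (hζ : ζ ∈ logStrip α) (k : ℕ) : ‖kernel α lm ζ‖ ≤ envelope lm k ζ.re := by
  have h1 := norm_kernel_le hsum hζ (k + 1)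
  have h2 := norm_kernel_le hsum hζ (k + 2)
  push_cast at h1 h2
  exact le_min (norm_kernel_le hsum hζ k) (le_min h1 h2)

lemma ofReal_sub_mem_logStrip {ζ : ℂ} (hζ : ζ ∈ logStrip α) (s : ℝ) : (s : ℂ) - ζ ∈ logStrip α := by
  rw [mem_logStrip] at hζ ⊢
  simpa using hζ

lemma continuous_kernel_sub (hsum : Summable fun p => Real.exp (-lm p / α)) {ζ : ℂ}
    (hζ : ζ ∈ logStrip α) : Continuous fun s : ℝ => kernel α lm (s - ζ) :=
  (differentiableOn_kernel hsum).continuousOn.comp_continuous (by fun_prop)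
    (ofReal_sub_mem_logStrip hζ)

lemma norm_kernel_sub_mul_le (hsum : Summable fun p => Real.exp (-lm p / α)) {ζ : ℂ}
    (hζ : ζ ∈ logStrip α) {ψ : ℝ → ℂ} {C : ℝ} {k : ℕ}
    (hψC : ∀ s, ‖ψ s‖ ≤ C * Real.exp ((k + 1) * s)) (s : ℝ) :
    ‖kernel α lm (s - ζ) * ψ s‖
      ≤ C * (envelope lm k (s - ζ.re) * Real.exp ((k + 1) * s)) := by
  have h1 := norm_kernel_le_envelope hsum (ofReal_sub_mem_logStrip hζ s) k
  rw [Complex.sub_re, Complex.ofReal_re] at h1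
  rw [norm_mul, mul_left_comm]
  exact mul_le_mul h1 (hψC s) (norm_nonneg _) (envelope_pos lm k _).le

lemma integrable_kernel_mul (hsum : Summable fun p => Real.exp (-lm p / α)) (hmono : Monotone lm)
    {ζ : ℂ} (hζ : ζ ∈ logStrip α) {ψ : ℝ → ℂ} (hψ : AEStronglyMeasurable ψ volume) {C : ℝ} {k : ℕ}
    (hψC : ∀ s, ‖ψ s‖ ≤ C * Real.exp ((k + 1) * s)) :
    Integrable fun s : ℝ => kernel α lm (s - ζ) * ψ s :=
  ((integral_envelope_translate hmono k ζ.re).1.const_mul C).mono'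
    ((continuous_kernel_sub hsum hζ).aestronglyMeasurable.mul hψ)
    (ae_of_all _ (norm_kernel_sub_mul_le hsum hζ hψC))

lemma norm_kernelTransform_le (hsum : Summable fun p => Real.exp (-lm p / α))
    (hmono : Monotone lm) {ζ : ℂ} (hζ : ζ ∈ logStrip α) {ψ : ℝ → ℂ} {C : ℝ} (hC : 0 ≤ C) {k : ℕ}
    (hψC : ∀ s, ‖ψ s‖ ≤ C * Real.exp ((k + 1) * s)) :
    ‖kernelTransform α lm ψ ζ‖ ≤ C * (Real.exp ζ.re ^ (k + 1) *
      (Real.exp (logSum lm (k + 1)) * (2 + (lm (k + 1) - lm k)))) := by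
  obtain ⟨h1, h2⟩ := integral_envelope_translate hmono k ζ.re
  refine (norm_integral_le_of_norm_le (h1.const_mul C)
    (ae_of_all _ (norm_kernel_sub_mul_le hsum hζ hψC))).trans ?_
  rw [integral_const_mul]
  gcongr

lemma differentiableOn_kernelTransform (hsum : Summable fun p => Real.exp (-lm p / α))
    (hmono : Monotone lm) {ψ : ℝ → ℂ} (hψ : AEStronglyMeasurable ψ volume) {C : ℝ} {k : ℕ}
    (hψC : ∀ s, ‖ψ s‖ ≤ C * Real.exp ((k + 1) * s)) :
    DifferentiableOn ℂ (kernelTransform α lm ψ) (logStrip α) := by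
  intro ζ hζ
  have hC : 0 ≤ C := nonneg_of_mul_nonneg_left ((norm_nonneg _).trans (hψC 0)) (Real.exp_pos _)
  -- One `ε` is for the neighbourhood of `ζ`, one for the Cauchy circle bounding the derivative of
  -- the kernel, and one is spare. Monotonicity of the envelope then gives a majorant, shifted by
  -- `2ε`, that is uniform in `η`.
  set ε : ℝ := (α * Real.pi / 2 - |ζ.im|) / 3 with hε
  have hε0 : 0 < ε := by have := mem_logStrip.1 hζ; rw [hε]; linarith
  have hclose : ∀ η : ℂ, ‖η - ζ‖ ≤ 2 * ε → η ∈ logStrip α := fun η hη => by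
    have h1 := (Complex.abs_im_le_norm (η - ζ)).trans hη
    have h2 := abs_add_le ζ.im (η - ζ).im
    rw [Complex.sub_im, add_sub_cancel] at h2
    rw [Complex.sub_im] at h1
    rw [mem_logStrip]
    linarith
  have hball : ∀ η ∈ Metric.ball ζ ε, η ∈ logStrip α := fun η hη =>
    hclose η ((mem_ball_iff_norm.1 hη).le.trans (by linarith))
  have hderiv : ∀ (s : ℝ), ∀ η ∈ logStrip α,
      HasDerivAt (fun η => kernel α lm (s - η) * ψ s) (-deriv (kernel α lm) (s - η) * ψ s) η := by
    intro s η hη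
    have h1 := ((differentiableOn_kernel hsum).differentiableAt
      ((isOpen_logStrip α).mem_nhds (ofReal_sub_mem_logStrip hη s))).hasDerivAt
    have h2 := HasDerivAt.comp η h1 ((hasDerivAt_id η).const_sub (s : ℂ))
    convert! h2.mul_const (ψ s) using 1
    ring
  have hbound : ∀ (s : ℝ), ∀ η ∈ Metric.ball ζ ε, ‖-deriv (kernel α lm) (s - η) * ψ s‖
      ≤ C / ε * (envelope lm k (s - (ζ.re + 2 * ε)) * Real.exp ((k + 1) * s)) := by
    intro s η hη
    have hnear : ∀ w ∈ Metric.closedBall ((s : ℂ) - η) ε,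
        w ∈ logStrip α ∧ s - (ζ.re + 2 * ε) ≤ w.re := by
      intro w hw
      have h1 : ‖(s - w) - ζ‖ ≤ 2 * ε := by
        have h2 : (s - w) - ζ = (η - ζ) - (w - (s - η)) := by ring
        rw [h2]
        have h3 := norm_sub_le (η - ζ) (w - (s - η))
        have h4 := mem_closedBall_iff_norm.1 hw
        have h5 := mem_ball_iff_norm.1 hη
        linarith
      constructor
      · have h2 := ofReal_sub_mem_logStrip (hclose _ h1) s
        rwa [sub_sub_cancel] at h2
      · have h2 := (Complex.re_le_norm _).trans h1
        simp only [Complex.sub_re, Complex.ofReal_re] at h2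
        linarith
    have h1 : ‖deriv (kernel α lm) (s - η)‖ ≤ envelope lm k (s - (ζ.re + 2 * ε)) / ε := by
      refine Complex.norm_deriv_le_of_forall_mem_sphere_norm_le hε0
        (((differentiableOn_kernel hsum).mono fun w hw => (hnear w hw).1).diffContOnCl_ball
          subset_rfl) fun w hw => ?_
      have h2 := hnear w (Metric.sphere_subset_closedBall hw)
      exact (norm_kernel_le_envelope hsum h2.1 k).trans (antitone_envelope lm k h2.2)
    rw [norm_mul, norm_neg]
    calc _ ≤ envelope lm k (s - (ζ.re + 2 * ε)) / ε * (C * Real.exp ((k + 1) * s)) :=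
          mul_le_mul h1 (hψC s) (norm_nonneg _)
            (div_nonneg (envelope_pos lm k _).le hε0.le)
      _ = _ := by ring
  have hdc : Continuous fun s : ℝ => deriv (kernel α lm) (s - ζ) :=
    ((differentiableOn_kernel hsum).deriv (isOpen_logStrip α)).continuousOn.comp_continuous
      (by fun_prop) (ofReal_sub_mem_logStrip hζ)
  have key := hasDerivAt_integral_of_dominated_loc_of_deriv_le (μ := volume)
    (F := fun (η : ℂ) (s : ℝ) => kernel α lm (s - η) * ψ s)
    (F' := fun (η : ℂ) (s : ℝ) => -deriv (kernel α lm) (s - η) * ψ s)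
    (Metric.ball_mem_nhds ζ hε0)
    (Filter.eventually_of_mem (Metric.ball_mem_nhds ζ hε0) fun η hη =>
      (continuous_kernel_sub hsum (hball η hη)).aestronglyMeasurable.mul hψ)
    (integrable_kernel_mul hsum hmono hζ hψ hψC)
    (hdc.neg.aestronglyMeasurable.mul hψ)
    (ae_of_all _ hbound)
    ((integral_envelope_translate hmono k (ζ.re + 2 * ε)).1.const_mul (C / ε))
    (ae_of_all _ fun s η hη => hderiv s η (hball η hη))
  exact key.2.differentiableAt.differentiableWithinAt

/-- The moments of the kernel. -/
noncomputable def moment (α : PosReal) (lm : ℕ → ℝ) (k : ℕ) : ℝ :=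
  ∫ s : ℝ, realKernel α lm s * Real.exp (k * s)

lemma norm_exp_natCast_mul_ofReal (k : ℕ) (s : ℝ) :
    ‖Complex.exp (((k + 1 : ℕ) : ℂ) * s)‖ = Real.exp ((k + 1) * s) := by
  rw [Complex.norm_exp]
  congr 1
  simp

/-- Divided by `z^(k+1)`, the transform is invariant under real translations of `ζ`, so its
derivative vanishes and it is constant on the strip; its value at `ζ = 0` is the moment. No rotation
of contours is needed. -/
lemma kernelTransform_exp (hsum : Summable fun p => Real.exp (-lm p / α)) (hmono : Monotone lm)
    (k : ℕ) {ζ : ℂ} (hζ : ζ ∈ logStrip α) :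
    kernelTransform α lm (fun s => Complex.exp (((k + 1 : ℕ) : ℂ) * s)) ζ
      = moment α lm (k + 1) * Complex.exp ζ ^ (k + 1) := by
  set ψ : ℝ → ℂ := fun s => Complex.exp (((k + 1 : ℕ) : ℂ) * s) with hψ
  have hψm : AEStronglyMeasurable ψ volume := by
    have : Continuous ψ := by fun_prop
    exact this.aestronglyMeasurable
  have hψC : ∀ s, ‖ψ s‖ ≤ 1 * Real.exp ((k + 1) * s) := fun s => by
    rw [one_mul]; exact (norm_exp_natCast_mul_ofReal k s).le
  have hd := differentiableOn_kernelTransform hsum hmono hψm hψC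
  set g : ℂ → ℂ := fun η => kernelTransform α lm ψ η * Complex.exp (-((k + 1 : ℕ) : ℂ) * η) with hg
  have hgd : DifferentiableOn ℂ g (logStrip α) := hd.mul (by fun_prop)
  have htrans : ∀ (η : ℂ) (t : ℝ), g (η + t) = g η := by
    intro η t
    have h1 : kernelTransform α lm ψ (η + t)
        = Complex.exp (((k + 1 : ℕ) : ℂ) * t) * kernelTransform α lm ψ η := by
      rw [kernelTransform, kernelTransform, ← integral_const_mul,
        ← integral_add_right_eq_self (fun s : ℝ => kernel α lm (s - (η + t)) * ψ s) t]
      refine integral_congr_ae (ae_of_all _ fun s => ?_)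
      simp only [hψ]
      rw [show ((s + t : ℝ) : ℂ) - (η + t) = s - η by push_cast; ring, mul_left_comm,
        ← Complex.exp_add]
      push_cast
      ring_nf
    simp only [hg]
    rw [h1, mul_comm (Complex.exp _), mul_assoc, ← Complex.exp_add]
    ring_nf
  have hderiv : Set.EqOn (deriv g) 0 (logStrip α) := by
    intro η hη
    have h1 := (hgd.differentiableAt ((isOpen_logStrip α).mem_nhds hη)).hasDerivAt
    have h2 : HasDerivAt (fun w : ℂ => g (η + w)) (deriv g η) ((0 : ℝ) : ℂ) := by
      have h3 : HasDerivAt (fun w : ℂ => η + w) 1 ((0 : ℝ) : ℂ) := (hasDerivAt_id _).const_add η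
      have h4 : HasDerivAt g (deriv g η) (η + ((0 : ℝ) : ℂ)) := by simpa using h1
      simpa [Function.comp_def] using HasDerivAt.comp _ h4 h3
    have h5 := h2.comp_ofReal
    simp only [htrans] at h5
    exact h5.unique (hasDerivAt_const _ _)
  have h0 : (0 : ℂ) ∈ logStrip α := by
    have := α.2
    rw [mem_logStrip, Complex.zero_im, abs_zero]
    positivity
  have hconst := (isOpen_logStrip α).is_const_of_deriv_eq_zero
    (convex_logStrip α).isPreconnected hgd hderiv hζ h0
  have hg0 : g 0 = moment α lm (k + 1) := by
    simp only [hg, kernelTransform, moment, mul_zero, Complex.exp_zero, mul_one, sub_zero]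
    rw [← integral_complex_ofReal]
    refine integral_congr_ae (ae_of_all _ fun s => ?_)
    simp only [hψ, kernel_ofReal]
    push_cast
    rfl
  rw [hg0] at hconst
  rw [← hconst]
  simp only [hg]
  rw [mul_assoc, ← Complex.exp_nat_mul, ← Complex.exp_add, neg_mul, neg_add_cancel,
    Complex.exp_zero, mul_one]

/-- The real kernel decreases, so up to `log m_(k+1)` it is at least its value there, and the
remaining exponential is integrated exactly. -/
lemma moment_ge (hsum : Summable fun p => Real.exp (-lm p / α)) (hmono : Monotone lm) (k : ℕ) :
    realKernel α lm (lm (k + 1)) * Real.exp ((k + 1) * lm (k + 1)) / (k + 1)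
      ≤ moment α lm (k + 1) := by
  have h0 : (0 : ℂ) ∈ logStrip α := by
    have := α.2
    rw [mem_logStrip, Complex.zero_im, abs_zero]
    positivity
  have hk : (0 : ℝ) < k + 1 := by positivity
  have hint : Integrable fun s : ℝ => realKernel α lm s * Real.exp (((k + 1 : ℕ) : ℝ) * s) := by
    have h1 := (integrable_kernel_mul hsum hmono h0 (k := k) (C := 1)
      (ψ := fun s : ℝ => Complex.exp (((k + 1 : ℕ) : ℂ) * s))
      (Continuous.aestronglyMeasurable (by fun_prop))
      (fun s => by rw [one_mul]; exact (norm_exp_natCast_mul_ofReal k s).le)).re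
    refine h1.congr (ae_of_all _ fun s => ?_)
    simp only [sub_zero, kernel_ofReal]
    rw [← Complex.ofReal_natCast, ← Complex.ofReal_mul, ← Complex.ofReal_exp, ← Complex.ofReal_mul]
    exact Complex.ofReal_re _
  have hset : ∫ s in Set.Iic (lm (k + 1)), realKernel α lm s * Real.exp (((k + 1 : ℕ) : ℝ) * s)
      ≤ moment α lm (k + 1) :=
    setIntegral_le_integral hint (ae_of_all _ fun s => by
      simp only [Pi.zero_apply, realKernel]; positivity)
  refine le_trans ?_ hset
  have hexp : IntegrableOn (fun s => Real.exp (((k + 1 : ℕ) : ℝ) * s)) (Set.Iic (lm (k + 1))) :=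
    integrableOn_exp_mul_Iic (by positivity) _
  have h2 : ∫ s in Set.Iic (lm (k + 1)), realKernel α lm (lm (k + 1)) *
      Real.exp (((k + 1 : ℕ) : ℝ) * s)
      ≤ ∫ s in Set.Iic (lm (k + 1)), realKernel α lm s * Real.exp (((k + 1 : ℕ) : ℝ) * s) :=
    setIntegral_mono_on (hexp.const_mul _) hint.integrableOn measurableSet_Iic fun s hs =>
      mul_le_mul_of_nonneg_right (antitone_realKernel hsum hs) (Real.exp_pos _).le
  refine le_trans (le_of_eq ?_) h2
  rw [integral_const_mul, integral_exp_mul_Iic (by positivity)]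
  push_cast
  ring

end

/-- The moments of the kernel are bounded below by the weight sequence, up to a geometric factor. -/
lemma exists_moment_lower_bound {lm : ℕ → ℝ} (hmono : Monotone lm) {β a : ℝ}
    (h : LogAlmostIncreasing lm β a) {α : PosReal} (hαβ : (α : ℝ) < β) :
    ∃ B : ℝ, 1 ≤ B ∧ ∀ k, Real.exp (logSum lm (k + 1)) ≤ B ^ (k + 2) * moment α lm (k + 1) := by
  have hα := α.2
  have hsum := h.summable hαβ
  set D : ℝ := Real.exp (a / α) * (1 + 1 / (β / α - 1)) with hD
  have hD0 : 0 ≤ D := by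
    have : 0 < β / α - 1 := sub_pos.2 ((one_lt_div hα).2 hαβ)
    positivity
  have hlog2 : 0 ≤ Real.log 2 := Real.log_nonneg (by norm_num)
  set A : ℝ := Real.exp (α * (Real.log 2 + D)) with hA
  have hA1 : 1 ≤ A := Real.one_le_exp (by positivity)
  -- `A` absorbs the loss in the lower bound of the kernel at `m_(k+1)`; the extra 2 absorbs the
  -- factor `k + 1` from integrating the exponential.
  refine ⟨2 * A, by linarith, fun k => ?_⟩
  obtain ⟨hDs, hDle⟩ := h.tail hαβ (k + 1)
  have h1 := realKernel_ge hsum hmono hDle hDs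
  have h2 := moment_ge hsum hmono k (α := α)
  have hk : (0 : ℝ) < k + 1 := by positivity
  have h3 : Real.exp (logSum lm (k + 1)) ≤
      A ^ (k + 2) * (realKernel α lm (lm (k + 1)) * Real.exp ((k + 1) * lm (k + 1))) := by
    calc Real.exp (logSum lm (k + 1)) ≤ A ^ (k + 2) *
          (Real.exp (logSum lm (k + 1) - (k + 1 : ℕ) * lm (k + 1) - α *
            ((k + 1 : ℕ) * Real.log 2 + D * ((k + 1 : ℕ) + 1))) *
            Real.exp ((k + 1) * lm (k + 1))) := by
          rw [hA, ← Real.exp_nat_mul, ← Real.exp_add, ← Real.exp_add]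
          refine Real.exp_le_exp.2 ?_
          push_cast
          have : 0 ≤ α * Real.log 2 := by positivity
          nlinarith
      _ ≤ _ := by gcongr
  have h4 : (k + 1 : ℝ) ≤ 2 ^ (k + 2) := by
    have := (Nat.lt_two_pow_self (n := k + 2)).le
    have h5 : ((k + 2 : ℕ) : ℝ) ≤ 2 ^ (k + 2) := by exact_mod_cast this
    push_cast at h5
    linarith
  rw [div_le_iff₀ hk] at h2
  have hmom : 0 ≤ moment α lm (k + 1) := by
    refine integral_nonneg fun s => ?_
    simp only [Pi.zero_apply, realKernel]
    positivity
  calc _ ≤ _ := h3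
    _ ≤ A ^ (k + 2) * (moment α lm (k + 1) * (k + 1)) := by gcongr
    _ ≤ A ^ (k + 2) * (moment α lm (k + 1) * 2 ^ (k + 2)) := by gcongr
    _ = _ := by ring

/-! ### The truncated Borel transform -/

/-- The sum `∑ b_k u ^ (k + 1)` at `u = e^s`, cut off at `s = ρ`. -/
noncomputable def cutoffSum (ρ : ℝ) (b : ℕ → ℂ) : ℝ → ℂ :=
  (Set.Iic ρ).indicator fun s => ∑' k, b k * Complex.exp (((k + 1 : ℕ) : ℂ) * s)

section

variable {ρ K : ℝ} {b : ℕ → ℂ}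

lemma norm_cutoffSum_term_le (hb : ∀ k, ‖b k‖ ≤ K * (Real.exp (-ρ) / 2) ^ (k + 1)) (k : ℕ) (s : ℝ) :
    ‖b k * Complex.exp (((k + 1 : ℕ) : ℂ) * s)‖
      ≤ K * (Real.exp (s - ρ) ^ (k + 1) * (1 / 2) ^ (k + 1)) := by
  rw [norm_mul, norm_exp_natCast_mul_ofReal]
  refine (mul_le_mul_of_nonneg_right (hb k) (Real.exp_pos _).le).trans_eq ?_
  have h1 : Real.exp ((k + 1) * s) = Real.exp s ^ (k + 1) := by
    rw [← Real.exp_nat_mul]; push_cast; rfl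
  rw [h1, sub_eq_add_neg s ρ, Real.exp_add, div_pow, mul_pow, div_pow, one_pow]
  ring

lemma nonneg_of_cutoffSum_bound (hb : ∀ k, ‖b k‖ ≤ K * (Real.exp (-ρ) / 2) ^ (k + 1)) : 0 ≤ K :=
  nonneg_of_mul_nonneg_left ((norm_nonneg _).trans (hb 0)) (by positivity)

lemma norm_cutoffSum_term_le_half (hb : ∀ k, ‖b k‖ ≤ K * (Real.exp (-ρ) / 2) ^ (k + 1)) (k : ℕ)
    {s : ℝ} (hs : s ≤ ρ) :
    ‖b k * Complex.exp (((k + 1 : ℕ) : ℂ) * s)‖ ≤ K * (1 / 2) ^ (k + 1) := by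
  have hK := nonneg_of_cutoffSum_bound hb
  refine (norm_cutoffSum_term_le hb k s).trans ?_
  have h1 : Real.exp (s - ρ) ^ (k + 1) ≤ 1 :=
    pow_le_one₀ (Real.exp_pos _).le (Real.exp_le_one_iff.2 (by linarith))
  refine mul_le_mul_of_nonneg_left ?_ hK
  exact mul_le_of_le_one_left (by positivity) h1

lemma summable_half_pow_succ (K : ℝ) : Summable fun k : ℕ => K * (1 / 2 : ℝ) ^ (k + 1) :=
  ((summable_nat_add_iff 1).2 summable_geometric_two).mul_left K

lemma summable_cutoffSum (hb : ∀ k, ‖b k‖ ≤ K * (Real.exp (-ρ) / 2) ^ (k + 1)) {s : ℝ}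
    (hs : s ≤ ρ) : Summable fun k => b k * Complex.exp (((k + 1 : ℕ) : ℂ) * s) :=
  Summable.of_norm_bounded (summable_half_pow_succ K) fun k => norm_cutoffSum_term_le_half hb k hs

lemma aestronglyMeasurable_cutoffSum (hb : ∀ k, ‖b k‖ ≤ K * (Real.exp (-ρ) / 2) ^ (k + 1)) :
    AEStronglyMeasurable (cutoffSum ρ b) volume := by
  rw [cutoffSum, aestronglyMeasurable_indicator_iff measurableSet_Iic]
  refine ContinuousOn.aestronglyMeasurable ?_ measurableSet_Iic
  exact continuousOn_tsum (fun k => by fun_prop) (summable_half_pow_succ K)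
    fun k s hs => norm_cutoffSum_term_le_half hb k hs

lemma sum_half_pow_succ (n : ℕ) : ∑ k ∈ Finset.range n, (1 / 2 : ℝ) ^ (k + 1) ≤ 1 := by
  have h : ∑ k ∈ Finset.range n, (1 / 2 : ℝ) ^ (k + 1) = 1 - (1 / 2) ^ n := by
    induction n with
    | zero => simp
    | succ n ih => rw [Finset.sum_range_succ, ih]; ring
  rw [h]
  have : (0 : ℝ) ≤ (1 / 2) ^ n := by positivity
  linarith

/-- Before the cutoff the error is a tail of the series, with powers of `e^(s-ρ) ≤ 1` of exponent at
least `p + 1`. Beyond it the error is the polynomial alone, with smaller powers of `e^(s-ρ) ≥ 1`. In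
both cases the factors `2^(-k-1)`, gained by cutting at half the guaranteed radius, have sum at most
1. -/
lemma norm_cutoffSum_sub_le (hb : ∀ k, ‖b k‖ ≤ K * (Real.exp (-ρ) / 2) ^ (k + 1)) (p : ℕ) (s : ℝ) :
    ‖cutoffSum ρ b s - ∑ k ∈ Finset.range p, b k * Complex.exp (((k + 1 : ℕ) : ℂ) * s)‖
      ≤ K * Real.exp (-ρ) ^ (p + 1) * Real.exp ((p + 1) * s) := by
  have hK := nonneg_of_cutoffSum_bound hb
  have hgoal : K * Real.exp (-ρ) ^ (p + 1) * Real.exp ((p + 1) * s)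
      = K * Real.exp (s - ρ) ^ (p + 1) := by
    rw [sub_eq_add_neg s ρ, Real.exp_add, mul_pow, ← Real.exp_nat_mul s]
    push_cast
    ring
  rw [hgoal]
  rcases le_or_gt s ρ with hs | hs
  · have h1 := summable_cutoffSum hb hs
    have hx : Real.exp (s - ρ) ≤ 1 := Real.exp_le_one_iff.2 (by linarith)
    rw [cutoffSum, Set.indicator_of_mem (Set.mem_Iic.2 hs), ← h1.sum_add_tsum_nat_add p,
      add_sub_cancel_left]
    have h2 : HasSum (fun k : ℕ => K * Real.exp (s - ρ) ^ (p + 1) * (1 / 2 : ℝ) ^ (k + 1))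
        (K * Real.exp (s - ρ) ^ (p + 1) * 1) := by
      refine HasSum.mul_left _ ?_
      have h3 := hasSum_geometric_two.mul_left (1 / 2 : ℝ)
      simpa [pow_succ, mul_comm] using h3
    rw [mul_one] at h2
    refine tsum_of_norm_bounded h2 fun k => ?_
    refine (norm_cutoffSum_term_le hb (k + p) s).trans ?_
    rw [mul_assoc]
    refine mul_le_mul_of_nonneg_left (mul_le_mul ?_ ?_ (by positivity) (by positivity)) hK
    · exact pow_le_pow_of_le_one (Real.exp_pos _).le hx (by omega)
    · exact pow_le_pow_of_le_one (by norm_num) (by norm_num) (by omega)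
  · have hx : 1 ≤ Real.exp (s - ρ) := Real.one_le_exp (by linarith)
    rw [cutoffSum, Set.indicator_of_notMem (by simpa using hs), zero_sub, norm_neg]
    calc _ ≤ ∑ k ∈ Finset.range p, K * Real.exp (s - ρ) ^ (p + 1) * (1 / 2 : ℝ) ^ (k + 1) := by
          refine norm_sum_le_of_le _ fun k hk => ?_
          refine (norm_cutoffSum_term_le hb k s).trans ?_
          rw [mul_assoc]
          have h4 : k + 1 ≤ p + 1 := by have := Finset.mem_range.1 hk; omega
          gcongr
      _ = K * Real.exp (s - ρ) ^ (p + 1) * ∑ k ∈ Finset.range p, (1 / 2 : ℝ) ^ (k + 1) := by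
          rw [Finset.mul_sum]
      _ ≤ K * Real.exp (s - ρ) ^ (p + 1) * 1 := by
          gcongr
          exact sum_half_pow_succ p
      _ = _ := mul_one _

lemma norm_cutoffSum_le (hb : ∀ k, ‖b k‖ ≤ K * (Real.exp (-ρ) / 2) ^ (k + 1)) (s : ℝ) :
    ‖cutoffSum ρ b s‖ ≤ K * Real.exp (-ρ) * Real.exp (((0 : ℕ) + 1) * s) := by
  simpa using norm_cutoffSum_sub_le hb 0 s

lemma cutoffSum_add {b' : ℕ → ℂ} {K' : ℝ}
    (hb : ∀ k, ‖b k‖ ≤ K * (Real.exp (-ρ) / 2) ^ (k + 1))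
    (hb' : ∀ k, ‖b' k‖ ≤ K' * (Real.exp (-ρ) / 2) ^ (k + 1)) :
    cutoffSum ρ (b + b') = cutoffSum ρ b + cutoffSum ρ b' := by
  funext s
  rcases le_or_gt s ρ with hs | hs
  · simp only [cutoffSum, Pi.add_apply, Set.indicator_of_mem (Set.mem_Iic.2 hs), add_mul]
    exact (summable_cutoffSum hb hs).tsum_add (summable_cutoffSum hb' hs)
  · have h1 : s ∉ Set.Iic ρ := by simpa using hs
    simp only [cutoffSum, Pi.add_apply, Set.indicator_of_notMem h1, add_zero]

lemma cutoffSum_smul (c : ℂ) (b : ℕ → ℂ) : cutoffSum ρ (c • b) = c • cutoffSum ρ b := by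
  funext s
  rcases le_or_gt s ρ with hs | hs
  · simp only [cutoffSum, Pi.smul_apply, Set.indicator_of_mem (Set.mem_Iic.2 hs), smul_eq_mul,
      mul_assoc]
    exact tsum_mul_left
  · have h1 : s ∉ Set.Iic ρ := by simpa using hs
    simp only [cutoffSum, Pi.smul_apply, Set.indicator_of_notMem h1, smul_zero]

end

/-! ### Transforms of cut off sums -/

section

variable {α : PosReal} {lm : ℕ → ℝ} {ρ K : ℝ} {b : ℕ → ℂ}

/-- This serves the remainder of order 0, which the envelope bounds miss since their moments begin
at order 1. Here the kernel is bounded by 1 and the cutoff gives integrability. -/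
lemma norm_kernelTransform_cutoffSum_le (hsum : Summable fun p => Real.exp (-lm p / α))
    (hb : ∀ k, ‖b k‖ ≤ K * (Real.exp (-ρ) / 2) ^ (k + 1)) {ζ : ℂ} (hζ : ζ ∈ logStrip α) :
    ‖kernelTransform α lm (cutoffSum ρ b) ζ‖ ≤ K := by
  have hK := nonneg_of_cutoffSum_bound hb
  have hint : IntegrableOn (fun s => K * Real.exp (-ρ) * Real.exp s) (Set.Iic ρ) :=
    (integrableOn_exp_Iic ρ).const_mul _
  have h1 : ∀ s : ℝ, ‖kernel α lm (s - ζ) * cutoffSum ρ b s‖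
      ≤ (Set.Iic ρ).indicator (fun s => K * Real.exp (-ρ) * Real.exp s) s := by
    intro s
    have h2 := norm_kernel_le hsum (ofReal_sub_mem_logStrip hζ s) 0
    simp only [logSum, Finset.range_zero, Finset.sum_empty, Nat.cast_zero, zero_mul, sub_zero,
      Real.exp_zero] at h2
    rcases le_or_gt s ρ with hs | hs
    · rw [Set.indicator_of_mem (Set.mem_Iic.2 hs), norm_mul]
      have h3 := norm_cutoffSum_le hb s
      simp only [Nat.cast_zero, zero_add, one_mul] at h3
      exact (mul_le_of_le_one_left (norm_nonneg _) h2).trans h3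
    · have h3 : s ∉ Set.Iic ρ := by simpa using hs
      rw [cutoffSum, Set.indicator_of_notMem h3, Set.indicator_of_notMem h3, mul_zero, norm_zero]
  refine (norm_integral_le_of_norm_le (hint.integrable_indicator measurableSet_Iic)
    (ae_of_all _ h1)).trans_eq ?_
  rw [integral_indicator measurableSet_Iic, integral_const_mul, integral_exp_Iic, mul_assoc,
    ← Real.exp_add, neg_add_cancel, Real.exp_zero, mul_one]

lemma kernelTransform_cutoffSum_sub (hsum : Summable fun p => Real.exp (-lm p / α))
    (hmono : Monotone lm) (hb : ∀ k, ‖b k‖ ≤ K * (Real.exp (-ρ) / 2) ^ (k + 1)) {ζ : ℂ}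
    (hζ : ζ ∈ logStrip α) (p : ℕ) :
    kernelTransform α lm (cutoffSum ρ b) ζ
        - ∑ k ∈ Finset.range p, b k * moment α lm (k + 1) * Complex.exp ζ ^ (k + 1)
      = kernelTransform α lm (fun s => cutoffSum ρ b s
        - ∑ k ∈ Finset.range p, b k * Complex.exp (((k + 1 : ℕ) : ℂ) * s)) ζ := by
  have h1 : Integrable fun s : ℝ => kernel α lm (s - ζ) * cutoffSum ρ b s :=
    integrable_kernel_mul hsum hmono hζ (aestronglyMeasurable_cutoffSum hb) (norm_cutoffSum_le hb)
  have h2 : ∀ k, Integrable fun s : ℝ =>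
      kernel α lm (s - ζ) * Complex.exp (((k + 1 : ℕ) : ℂ) * s) := fun k =>
    integrable_kernel_mul hsum hmono hζ (Continuous.aestronglyMeasurable (by fun_prop)) (C := 1)
      (fun s => by rw [one_mul]; exact (norm_exp_natCast_mul_ofReal k s).le)
  have h3 : ∀ s : ℝ, kernel α lm (s - ζ) * (cutoffSum ρ b s
      - ∑ k ∈ Finset.range p, b k * Complex.exp (((k + 1 : ℕ) : ℂ) * s))
      = kernel α lm (s - ζ) * cutoffSum ρ b s - ∑ k ∈ Finset.range p,
        b k * (kernel α lm (s - ζ) * Complex.exp (((k + 1 : ℕ) : ℂ) * s)) := fun s => by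
    rw [mul_sub, Finset.mul_sum]
    congr 1
    exact Finset.sum_congr rfl fun k _ => by ring
  rw [kernelTransform, kernelTransform]
  simp only [h3]
  rw [integral_sub h1 (integrable_finsetSum _ fun k _ => (h2 k).const_mul _),
    integral_finsetSum _ fun k _ => (h2 k).const_mul _]
  congr 1
  refine Finset.sum_congr rfl fun k _ => ?_
  rw [integral_const_mul, mul_assoc, ← kernelTransform_exp hsum hmono k hζ]
  rfl

lemma kernelTransform_add_cutoffSum (hsum : Summable fun p => Real.exp (-lm p / α))
    (hmono : Monotone lm) {b' : ℕ → ℂ} {K' : ℝ}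
    (hb : ∀ k, ‖b k‖ ≤ K * (Real.exp (-ρ) / 2) ^ (k + 1))
    (hb' : ∀ k, ‖b' k‖ ≤ K' * (Real.exp (-ρ) / 2) ^ (k + 1)) {ζ : ℂ} (hζ : ζ ∈ logStrip α) :
    kernelTransform α lm (cutoffSum ρ (b + b')) ζ
      = kernelTransform α lm (cutoffSum ρ b) ζ + kernelTransform α lm (cutoffSum ρ b') ζ := by
  rw [cutoffSum_add hb hb', kernelTransform, kernelTransform, kernelTransform, ← integral_add
    (integrable_kernel_mul hsum hmono hζ (aestronglyMeasurable_cutoffSum hb) (norm_cutoffSum_le hb))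
    (integrable_kernel_mul hsum hmono hζ (aestronglyMeasurable_cutoffSum hb')
      (norm_cutoffSum_le hb'))]
  simp only [Pi.add_apply, mul_add]

lemma kernelTransform_smul (c : ℂ) (ψ : ℝ → ℂ) (ζ : ℂ) :
    kernelTransform α lm (c • ψ) ζ = c * kernelTransform α lm ψ ζ := by
  rw [kernelTransform, kernelTransform, ← integral_const_mul]
  simp only [Pi.smul_apply, smul_eq_mul, mul_left_comm]

end

/-! ### Weight sequences and their quotients -/

namespace PosSeq

/-- The logarithms of the quotients. -/
noncomputable def logQuot (M : PosSeq) (p : ℕ) : ℝ := Real.log (M.quot p)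

lemma quot_pos (M : PosSeq) (p : ℕ) : 0 < M.quot p := div_pos (M.pos' _) (M.pos' _)

lemma exp_logSum (M : PosSeq) (k : ℕ) : Real.exp (logSum M.logQuot k) = M k := by
  induction k with
  | zero => simp [logSum, M.zero']
  | succ k ih =>
    rw [logSum_succ, Real.exp_add, ih, logQuot, Real.exp_log (M.quot_pos k), quot,
      mul_div_cancel₀ _ (M.pos' k).ne']

lemma LogConvex.monotone_logQuot {M : PosSeq} (hM : M.LogConvex) : Monotone M.logQuot := by
  refine monotone_nat_of_le_succ fun p => Real.log_le_log (M.quot_pos p) ?_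
  rw [quot, quot, div_le_div_iff₀ (M.pos' _) (M.pos' _)]
  have := hM p
  rw [show p + 1 + 1 = p + 2 from rfl]
  linarith [sq (M (p + 1))]

end PosSeq

lemma AlmostIncreasing.logAlmostIncreasing {M : PosSeq} {β : ℝ}
    (h : AlmostIncreasing fun p => M.quot p / ((p : ℝ) + 1) ^ β) :
    ∃ a, LogAlmostIncreasing M.logQuot β a := by
  obtain ⟨a, ha, h⟩ := h
  refine ⟨Real.log a, fun k p hkp => ?_⟩
  have hk : (0 : ℝ) < (k : ℝ) + 1 := by positivity
  have hp : (0 : ℝ) < (p : ℝ) + 1 := by positivity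
  have hq₁ := M.quot_pos k
  have hq₂ := M.quot_pos p
  have h1 := Real.log_le_log (by positivity) (h k p hkp)
  rw [Real.log_mul ha.ne' (by positivity), Real.log_div hq₁.ne' (by positivity),
    Real.log_div hq₂.ne' (by positivity), Real.log_rpow hk, Real.log_rpow hp] at h1
  simp only [PosSeq.logQuot]
  linarith

lemma exists_almostIncreasing_of_lt_gammaIndex {M : PosSeq} {γ : ℝ}
    (h : ENNReal.ofReal γ < gammaIndex M) :
    ∃ β, γ < β ∧ AlmostIncreasing fun p => M.quot p / ((p : ℝ) + 1) ^ β := by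
  obtain ⟨_, ⟨β, ⟨hβ, hinc⟩, rfl⟩, hlt⟩ := lt_sSup_iff.1 h
  exact ⟨β, (ENNReal.ofReal_lt_ofReal_iff hβ).1 hlt, hinc⟩

lemma PosSeq.ShiftedMoments.logQuot_sub_le {M : PosSeq} (h : M.ShiftedMoments) :
    ∃ C₀ H : ℝ, 0 < C₀ ∧ 1 < H ∧ ∀ p, M.logQuot (p + 1) - M.logQuot p ≤ C₀ * H ^ (p + 1) := by
  obtain ⟨C₀, H, hC, hH, h⟩ := h
  refine ⟨C₀, H, hC, hH, fun p => ?_⟩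
  rw [logQuot, logQuot, ← Real.log_div (M.quot_pos _).ne' (M.quot_pos _).ne']
  exact h p

/-! ### Extension operators -/

lemma Formal.norm_coeff_le {M : PosSeq} {h : PosReal} (a : Formal M h) (p : ℕ) :
    ‖PowerSeries.coeff p a.val‖ ≤ ‖a‖ * ((h : ℝ) ^ p * M p) := by
  have hpos : ∀ p : ℕ, 0 < (h : ℝ) ^ p * M p := fun p => mul_pos (pow_pos h.2 p) (M.pos' p)
  rw [← div_le_iff₀ (hpos p)]
  obtain ⟨C, hC⟩ := a.2
  refine le_ciSup (f := fun p : ℕ => ‖PowerSeries.coeff p a.val‖ / ((h : ℝ) ^ p * M p))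
    ⟨C, ?_⟩ p
  rintro _ ⟨q, rfl⟩
  exact (div_le_iff₀ (hpos q)).2 (hC q)

/-- The formal Borel transform with respect to the moments of the kernel. -/
noncomputable def formalBorel (α : PosReal) (lm : ℕ → ℝ) (a : PowerSeries ℂ) (k : ℕ) : ℂ :=
  PowerSeries.coeff (k + 1) a / moment α lm (k + 1)

/-- The truncated Laplace transform of the formal Borel transform. -/
noncomputable def extension (α : PosReal) (lm : ℕ → ℝ) (ρ : ℝ) (γ : PosReal) (a : PowerSeries ℂ) :
    Sector γ → ℂ :=
  fun z => PowerSeries.coeff 0 a +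
    kernelTransform α lm (cutoffSum ρ (formalBorel α lm a)) z.1.log

section

variable {α γ : PosReal} {M : PosSeq} {B ρ : ℝ} {h : PosReal}

/-- The cutoff `e^ρ = 1/(2hB)` is half the guaranteed radius of convergence `1/(hB)`; the surplus
factor of `B^(k+2)` goes into the constant. -/
lemma norm_formalBorel_le (hB : 1 ≤ B)
    (hmom : ∀ k, M (k + 1) ≤ B ^ (k + 2) * moment α M.logQuot (k + 1))
    (hρ : Real.exp (-ρ) = 2 * h * B) (a : Formal M h) (k : ℕ) :
    ‖formalBorel α M.logQuot a.val k‖ ≤ ‖a‖ * B * (Real.exp (-ρ) / 2) ^ (k + 1) := by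
  have hh := h.2
  have hpos : 0 < moment α M.logQuot (k + 1) :=
    pos_of_mul_pos_right ((M.pos' (k + 1)).trans_le (hmom k)) (by positivity)
  rw [formalBorel, norm_div, Complex.norm_real, Real.norm_of_nonneg hpos.le, div_le_iff₀ hpos, hρ]
  have hd : 2 * (h : ℝ) * B / 2 = h * B := by ring
  rw [hd]
  calc _ ≤ ‖a‖ * ((h : ℝ) ^ (k + 1) * M (k + 1)) := a.norm_coeff_le (k + 1)
    _ ≤ ‖a‖ * ((h : ℝ) ^ (k + 1) * (B ^ (k + 2) * moment α M.logQuot (k + 1))) := by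
        gcongr
        exact hmom k
    _ = _ := by ring

lemma holomorphic_extension (hsum : Summable fun p => Real.exp (-M.logQuot p / α))
    (hmono : Monotone M.logQuot) (hγ : (γ : ℝ) ≤ α) {a : PowerSeries ℂ} {K : ℝ}
    (hb : ∀ k, ‖formalBorel α M.logQuot a k‖ ≤ K * (Real.exp (-ρ) / 2) ^ (k + 1)) :
    Holomorphic (extension α M.logQuot ρ γ a) := by
  have h1 := (differentiableOn_kernelTransform hsum hmono (aestronglyMeasurable_cutoffSum hb)
    (norm_cutoffSum_le hb)).const_add (PowerSeries.coeff 0 a)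
  refine (h1.mono (logStrip_mono hγ)).congr fun ζ hζ => ?_
  exact inLog_apply (extension α M.logQuot ρ γ a) ⟨⟨ζ⟩, hζ⟩

lemma norm_remainder_extension_le (hsum : Summable fun p => Real.exp (-M.logQuot p / α))
    (hmono : Monotone M.logQuot) (hγ : (γ : ℝ) ≤ α) (hB : 1 ≤ B)
    (hmom : ∀ k, M (k + 1) ≤ B ^ (k + 2) * moment α M.logQuot (k + 1))
    (hρ : Real.exp (-ρ) = 2 * h * B) {C₀ H : ℝ} (hC₀ : 0 < C₀) (hH : 1 < H)
    (hsm : ∀ p, M.logQuot (p + 1) - M.logQuot p ≤ C₀ * H ^ (p + 1)) (a : Formal M h) (p : ℕ)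
    (z : Sector γ) :
    ‖remainder (extension α M.logQuot ρ γ a.val) a.val p z‖
      ≤ (1 + B * (2 + C₀)) * ‖a‖ * ((2 * B * H * h) ^ p * M p * z.1.abs ^ p) := by
  have hh := h.2
  have hz := logStrip_mono hγ z.2
  have hb := norm_formalBorel_le hB hmom hρ a
  have ha0 := norm_nonneg a
  rcases p with _ | p
  · have h1 := norm_kernelTransform_cutoffSum_le hsum hb hz
    have h2 := a.norm_coeff_le 0
    simp only [pow_zero, M.zero', mul_one] at h2
    simp only [remainder, extension, Finset.range_zero, Finset.sum_empty, sub_zero, pow_zero,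
      M.zero', mul_one]
    refine (norm_add_le _ _).trans ((add_le_add h2 h1).trans ?_)
    have : 0 ≤ ‖a‖ * B * (1 + C₀) := by positivity
    linarith
  · have hpos : ∀ k, 0 < moment α M.logQuot (k + 1) := fun k =>
      pos_of_mul_pos_right ((M.pos' (k + 1)).trans_le (hmom k)) (by positivity)
    -- The constant term cancels, since it is added outside the transform; order `p + 1` thus
    -- corresponds to the first `p` terms of the Borel series, whose exponents start at 1.
    have h1 : remainder (extension α M.logQuot ρ γ a.val) a.val (p + 1) z
        = kernelTransform α M.logQuot (fun s => cutoffSum ρ (formalBorel α M.logQuot a.val) s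
          - ∑ k ∈ Finset.range p, formalBorel α M.logQuot a.val k *
            Complex.exp (((k + 1 : ℕ) : ℂ) * s)) z.1.log := by
      rw [← kernelTransform_cutoffSum_sub hsum hmono hb hz, remainder, Finset.sum_range_succ',
        extension]
      have h2 : ∀ k, formalBorel α M.logQuot a.val k * moment α M.logQuot (k + 1)
          = PowerSeries.coeff (k + 1) a.val := fun k =>
        div_mul_cancel₀ _ (Complex.ofReal_ne_zero.2 (hpos k).ne')
      simp only [h2, pow_zero, mul_one]
      rw [add_comm (∑ k ∈ Finset.range p, _), add_sub_add_left_eq_sub]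
      rfl
    rw [h1]
    refine (norm_kernelTransform_le hsum hmono hz (by positivity)
      (norm_cutoffSum_sub_le hb p)).trans ?_
    rw [M.exp_logSum, hρ]
    have hM := M.pos' (p + 1)
    have hHp : 1 ≤ H ^ (p + 1) := one_le_pow₀ hH.le
    -- By (sm), the logarithmic loss of the envelope only multiplies the type by `H`.
    have h3 : 2 + (M.logQuot (p + 1) - M.logQuot p) ≤ (2 + C₀) * H ^ (p + 1) := by
      nlinarith [hsm p]
    have hzp : 0 < z.1.abs := z.1.abs_pos
    change ‖a‖ * B * (2 * h * B) ^ (p + 1) * (z.1.abs ^ (p + 1) * _) ≤ _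
    calc _ ≤ ‖a‖ * B * (2 * h * B) ^ (p + 1) * (z.1.abs ^ (p + 1) *
          (M (p + 1) * ((2 + C₀) * H ^ (p + 1)))) := by gcongr
      _ = (B * (2 + C₀)) * ‖a‖ * ((2 * B * H * h) ^ (p + 1) * M (p + 1) * z.1.abs ^ (p + 1)) := by
          ring
      _ ≤ _ := by
          gcongr
          linarith

lemma extension_add (hsum : Summable fun p => Real.exp (-M.logQuot p / α))
    (hmono : Monotone M.logQuot) (hγ : (γ : ℝ) ≤ α) {a a' : PowerSeries ℂ} {K K' : ℝ}
    (hb : ∀ k, ‖formalBorel α M.logQuot a k‖ ≤ K * (Real.exp (-ρ) / 2) ^ (k + 1))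
    (hb' : ∀ k, ‖formalBorel α M.logQuot a' k‖ ≤ K' * (Real.exp (-ρ) / 2) ^ (k + 1)) :
    extension α M.logQuot ρ γ (a + a')
      = extension α M.logQuot ρ γ a + extension α M.logQuot ρ γ a' := by
  funext z
  have h1 : formalBorel α M.logQuot (a + a')
      = formalBorel α M.logQuot a + formalBorel α M.logQuot a' := by
    funext k
    simp only [formalBorel, Pi.add_apply, map_add, add_div]
  simp only [extension, Pi.add_apply, h1, map_add]
  rw [kernelTransform_add_cutoffSum hsum hmono hb hb' (logStrip_mono hγ z.2)]
  ring

lemma extension_smul (c : ℂ) (a : PowerSeries ℂ) :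
    extension α M.logQuot ρ γ (c • a) = c • extension α M.logQuot ρ γ a := by
  funext z
  have h1 : formalBorel α M.logQuot (c • a) = c • formalBorel α M.logQuot a := by
    funext k
    simp only [formalBorel, Pi.smul_apply, map_smul, smul_eq_mul, mul_div_assoc]
  simp only [extension, Pi.smul_apply, h1, map_smul, cutoffSum_smul, kernelTransform_smul,
    smul_eq_mul, mul_add]

end

theorem hasLocalExtensionOperators_of_lt_gammaIndex {M : PosSeq} (hM : M.LogConvex)
    (hsm : M.ShiftedMoments) {γ : PosReal} (hγ : ENNReal.ofReal γ < gammaIndex M) :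
    HasLocalExtensionOperators M γ := by
  obtain ⟨β, hγβ, hinc⟩ := exists_almostIncreasing_of_lt_gammaIndex hγ
  obtain ⟨a₀, ha₀⟩ := hinc.logAlmostIncreasing
  -- `α < β` gives the tail estimates, and `γ ≤ α` places `S_γ` inside the sector of the kernel.
  obtain ⟨α, hγα, hαβ⟩ := exists_between hγβ
  obtain ⟨C₀, H, hC₀, hH, hquot⟩ := hsm.logQuot_sub_le
  lift α to PosReal using γ.2.trans hγα
  have hmono := hM.monotone_logQuot
  have hsum := ha₀.summable hαβ
  obtain ⟨B, hB, hmom⟩ := exists_moment_lower_bound hmono ha₀ hαβ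
  simp only [PosSeq.exp_logSum] at hmom
  -- `2B` comes from the cutoff `e^(-ρ) = 2hB` and `H` from (sm); neither depends on `h`.
  refine ⟨⟨2 * B * H, by positivity⟩, fun h => ?_⟩
  have hh := h.2
  set ρ : ℝ := -Real.log (2 * h * B) with hρ'
  have hρ : Real.exp (-ρ) = 2 * h * B := by rw [hρ', neg_neg, Real.exp_log (by positivity)]
  have hb := norm_formalBorel_le hB hmom hρ
  have hrem := norm_remainder_extension_le hsum hmono hγα.le hB hmom hρ hC₀ hH hquot
  have hexp : ∀ a : Formal M h, HasUniformExpansion M (⟨2 * B * H, by positivity⟩ * h)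
      (extension α M.logQuot ρ γ a.val) a.val := fun a => by
    have ha := norm_nonneg a
    -- The `+ 1` only makes the constant positive when `a = 0`; continuity of the operator uses the
    -- homogeneous bound `hrem`.
    refine ⟨(1 + B * (2 + C₀)) * ‖a‖ + 1, by positivity, fun p z => (hrem a p z).trans ?_⟩
    have := weight_pos M (⟨2 * B * H, by positivity⟩ * h) p z
    refine mul_le_mul_of_nonneg_right (by linarith) this.le
  let T : Formal M h →ₗ[ℂ] Uniform M (⟨2 * B * H, by positivity⟩ * h) γ :=
    { toFun := fun a => ⟨extension α M.logQuot ρ γ a.val,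
        holomorphic_extension hsum hmono hγα.le (hb a), a.val, hexp a⟩
      map_add' := fun a b => Subtype.ext
        (extension_add hsum hmono hγα.le (hb a) (hb b))
      map_smul' := fun c a => Subtype.ext (extension_smul c a.val) }
  have hT : ∀ a, (T a).val = extension α M.logQuot ρ γ a.val := fun a => rfl
  have hborel : ∀ a, borel M (T a).val = a.val := fun a => by
    rw [hT]
    exact (hexp a).borel_eq
  refine ⟨T.mkContinuous (1 + B * (2 + C₀)) fun a => ?_, hborel⟩
  have : Nonempty (Sector γ × ℕ) := ⟨(Sector.ofPos γ 1, 0)⟩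
  refine ciSup_le fun x => ?_
  rw [div_le_iff₀ (weight_pos M _ x.2 x.1), hborel, hT]
  exact hrem a x.2 x.1

lemma HasLocalExtensionOperators.uniformBorelSurjective {M : PosSeq} {γ : PosReal}
    (h : HasLocalExtensionOperators M γ) : UniformBorelSurjective M γ := by
  obtain ⟨c, hc⟩ := h
  intro a ha
  obtain ⟨k, hk⟩ := Set.mem_iUnion.1 ha
  obtain ⟨T, hT⟩ := hc k
  exact ⟨(T ⟨a, hk⟩).val, Set.mem_iUnion.2 ⟨c * k, (T ⟨a, hk⟩).2⟩, hT ⟨a, hk⟩⟩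

end Ultraholomorphic

/-! ### Assembly of the implications and of the inclusions between the intervals. -/

theorem theorem3p2 (M : PosSeq) (hM : M.IsWeightSequence) (hsm : M.ShiftedMoments)
    (hpos : 0 < gammaIndex M) :
    (∀ γ : PosReal,
      (ENNReal.ofReal γ < gammaIndex M → HasLocalExtensionOperators M γ) ∧
      (HasLocalExtensionOperators M γ → UniformBorelSurjective M γ) ∧
      (UniformBorelSurjective M γ ↔ Set.Ioc 0 (γ : ℝ) ⊆ uniformSurjInterval M) ∧
      (UniformBorelSurjective M γ → Set.Ioo 0 (γ : ℝ) ⊆ derivSurjInterval M)) ∧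
    {γ : ℝ | 0 < γ ∧ ENNReal.ofReal γ < gammaIndex M} ⊆ derivSurjInterval M ∧
    derivSurjInterval M ⊆ uniformSurjInterval M := by
  refine ⟨fun γ => ⟨hasLocalExtensionOperators_of_lt_gammaIndex hM.1 hsm,
    HasLocalExtensionOperators.uniformBorelSurjective, ⟨fun h δ hδ => ?_, fun h => ?_⟩,
    fun h δ hδ => ?_⟩, ?_, ?_⟩
  · exact ⟨hδ.1, h.mono (δ := ⟨δ, hδ.1⟩) hδ.2⟩
  · exact (h ⟨γ.2, le_rfl⟩).2
  · exact ⟨hδ.1, h.deriv (δ := ⟨δ, hδ.1⟩) hδ.2⟩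
  · rintro δ ⟨hδ, hlt⟩
    obtain ⟨β, hδβ, hinc⟩ := exists_almostIncreasing_of_lt_gammaIndex hlt
    -- Passing to bounds for the derivatives loses some opening, so surjectivity is first obtained
    -- on a larger sector whose opening is still below the index.
    obtain ⟨γ, hδγ, hγβ⟩ := exists_between hδβ
    have hγ : 0 < γ := hδ.trans hδγ
    have hγlt : ENNReal.ofReal γ < gammaIndex M :=
      ((ENNReal.ofReal_lt_ofReal_iff (hγ.trans hγβ)).2 hγβ).trans_le
        (le_sSup ⟨β, ⟨hγ.trans hγβ, hinc⟩, rfl⟩)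
    have h1 := (hasLocalExtensionOperators_of_lt_gammaIndex (γ := ⟨γ, hγ⟩) hM.1 hsm
      hγlt).uniformBorelSurjective
    exact ⟨hδ, h1.deriv (δ := ⟨δ, hδ⟩) hδγ⟩
  · rintro δ ⟨hδ, h⟩
    exact ⟨hδ, h.uniform⟩
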